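/- Fix an integer $d\ge 1$ and let $$\mathcal{C}(\mathbf z,t)=\frac{1}{1-z_1t-z_2t^2-\cdots-z_dt^d-\frac{t^{d+1}}{1-t}},$$ expanded as a power series in $t$ with coefficients in $\mathbb{R}[z_1,\dots,z_d]$. Then $\mathcal C$ is the generating function of integer compositions enumerated by size and by the number of occurrences of each of $1,\dots,d$: for all $n\ge 0$ and $\mathbf s\in\mathbb{N}^d$ (where $0\in\mathbb N$), the coefficient $[z_1^{s_1}\cdots z_d^{s_d}t^n]\,\mathcal C(\mathbf z,t)$ is the number of compositions of $n$ in which, for every $1\le k\le d$, exactly $s_k$ summands equal $k$. Let $$A_n = 2^n n^{-d/2}\,\frac{2^{\frac{d^2}{4}+\frac{7d}{4}+1}}{2(2\pi)^{d/2}\sqrt{(d^2+4d+6)2^d-2}},\qquad \mathbf m=\left(\tfrac14,\tfrac18,\dots,\tfrac1{2^{d+1}}\right),$$ and let $\mathcal H$ be the $d\times d$ matrix with off-diagonal entries $\mathcal H_{i,j}=-2^{-i-j-2}(i+j-3)$ and diagonal entries $\mathcal H_{j,j}=2^{-2(j+1)}(2^{j+1}-2j+3)$ for $1\le i,j\le d$.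 Then $\mathcal H$ is nonsingular. As $n\to\infty$, the maximum coefficient of $[t^n]\,\mathcal C(\mathbf z,t)$, as a polynomial in $z_1,\dots,z_d$, is asymptotic to $A_n$ (their ratio tends to $1$), and $$\sup_{\mathbf s\in\mathbb{N}^d}\left|\frac{[z_1^{s_1}\cdots z_d^{s_d}t^n]\,\mathcal C(\mathbf z,t)}{A_n}-\exp\left[-\frac{(\mathbf s-n\mathbf m)\,\mathcal H^{-1}(\mathbf s-n\mathbf m)^T}{2n}\right]\right|\longrightarrow 0.$$ -/

import Mathlib

open Filter Topology
open scoped Matrix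

noncomputable section

namespace CompositionLCLT

/-- The polynomial ring `ℝ[z₁, …, z_d]`; the variable `z_k` (`1 ≤ k ≤ d`) is `X i` with
`k = i + 1`, `i : Fin d`. Power series in `t` have their coefficients in this ring. -/
abbrev Poly (d : ℕ) : Type := MvPolynomial (Fin d) ℝ

/-- The power series expansion of `1 / (1 - t)`. -/
def oneDivOneSub (d : ℕ) : PowerSeries (Poly d) :=
  PowerSeries.invOfUnit (1 - PowerSeries.X) 1

/-- The denominator `1 - z₁ t - z₂ t² - ⋯ - z_d t^d - t^(d+1) / (1 - t)`. -/
def denom (d : ℕ) : PowerSeries (Poly d) :=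
  1 - ∑ k : Fin d, PowerSeries.C (MvPolynomial.X k) * PowerSeries.X ^ ((k : ℕ) + 1)
    - PowerSeries.X ^ (d + 1) * oneDivOneSub d

/-- The power series expansion of
`C(z, t) = 1 / (1 - z₁ t - ⋯ - z_d t^d - t^(d+1) / (1 - t))`. -/
def genFun (d : ℕ) : PowerSeries (Poly d) :=
  PowerSeries.invOfUnit (denom d) 1

/-- `oneDivOneSub` really is the multiplicative inverse of `1 - t`. -/
theorem one_sub_mul_oneDivOneSub (d : ℕ) :
    (1 - PowerSeries.X) * oneDivOneSub d = 1 :=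
  PowerSeries.mul_invOfUnit _ _ (by simp)

/-- `genFun` really is the multiplicative inverse of the denominator. -/
theorem denom_mul_genFun (d : ℕ) : denom d * genFun d = 1 :=
  PowerSeries.mul_invOfUnit _ _ (by simp [denom])

/-- The coefficient `[z₁^(s₁) ⋯ z_d^(s_d) t^n] C(z, t)`. -/
def coeffC (d n : ℕ) (s : Fin d →₀ ℕ) : ℝ :=
  MvPolynomial.coeff s (PowerSeries.coeff n (genFun d))

/-- The number of compositions of `n` in which, for each `1 ≤ k ≤ d`, the number `k` occurs
exactly `s_k` times as a summand. -/
def numCompositions (d n : ℕ) (s : Fin d →₀ ℕ) : ℕ :=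
  Nat.card {c : Composition n // ∀ k : Fin d, c.blocks.count ((k : ℕ) + 1) = s k}

/-- `A_n = 2^n n^(-d/2) · 2^(d²/4 + 7d/4 + 1) / (2 (2π)^(d/2) √((d² + 4d + 6) 2^d - 2))`. -/
def A (d n : ℕ) : ℝ :=
  (2 : ℝ) ^ n * (n : ℝ) ^ (-((d : ℝ) / 2)) *
    ((2 : ℝ) ^ ((d : ℝ) ^ 2 / 4 + 7 * (d : ℝ) / 4 + 1) /
      (2 * (2 * Real.pi) ^ ((d : ℝ) / 2) *
        Real.sqrt (((d : ℝ) ^ 2 + 4 * (d : ℝ) + 6) * (2 : ℝ) ^ d - 2)))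

/-- The mean vector `m = (1/4, 1/8, …, 1/2^(d+1))`: its `k`-th entry, `k = i + 1`, is
`1 / 2^(k+1)`. -/
def mean (d : ℕ) : Fin d → ℝ :=
  fun i => 1 / (2 : ℝ) ^ (((i : ℕ) + 1) + 1)

/-- Entry `(i, j)`, `1 ≤ i, j ≤ d`, of the Hessian: `-2^(-i-j-2) (i + j - 3)` for `i ≠ j` and
`2^(-2(j+1)) (2^(j+1) - 2j + 3)` for `i = j`. -/
def hessEntry (i j : ℕ) : ℝ :=
  if i = j then (2 : ℝ) ^ (-2 * ((j : ℤ) + 1)) * ((2 : ℝ) ^ (j + 1) - 2 * (j : ℝ) + 3)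
  else -(2 : ℝ) ^ (-(i : ℤ) - (j : ℤ) - 2) * ((i : ℝ) + (j : ℝ) - 3)

/-- The `d × d` Hessian matrix, with rows and columns numbered `1, …, d`. -/
def hess (d : ℕ) : Matrix (Fin d) (Fin d) ℝ :=
  Matrix.of fun i j => hessEntry ((i : ℕ) + 1) ((j : ℕ) + 1)

/-- The deviation vector `s - n m`. -/
def dev (d n : ℕ) (s : Fin d →₀ ℕ) : Fin d → ℝ :=
  fun i => (s i : ℝ) - (n : ℝ) * mean d i

/-- The Gaussian profile `exp(-(s - n m) H⁻¹ (s - n m)ᵀ / (2 n))`. -/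
def gauss (d n : ℕ) (s : Fin d →₀ ℕ) : ℝ :=
  Real.exp (-((dev d n s ᵥ* (hess d)⁻¹) ⬝ᵥ dev d n s) / (2 * (n : ℝ)))

end CompositionLCLT

end

/-!
Write `aₙ(z) = [tⁿ] C(z, t)`. Sorting compositions by their first summand gives
`aₙ₊₁ = ∑ wⱼ aₙ₋ⱼ`, where `wⱼ` is the weight of the summand `j + 1`, and this recurrence identifies
the coefficients of `C` with numbers of compositions (`coeffC_eq_numCompositions`). The local limit
theorem is proved by Fourier inversion: the coefficients of `aₙ` are its Fourier coefficients on
the torus `z = e^{iθ}`, and after rescaling `θ = u / √n` the error of the Gaussian approximation is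
bounded, uniformly in `s`, by the `L¹` distance between the rescaled `aₙ` and the Gaussian
`½ exp(-u 𝓗 uᵀ / 2)` (`abs_coeffC_div_sub_gauss_le`). This distance tends to `0` by dominated
convergence, for which two facts about `aₙ` are needed.

*Domination* (`norm_evalCoeff_torusPoint_le`): `|aₙ(e^{iθ})| ≤ 2ⁿ 2^d exp(-c n |θ|²)` on the cube
`[-π, π]^d`. Splitting a composition at the first partial sum exceeding `d` gives a
recurrence for `aₙ` whose coefficients for large jumps are all equal to `∑_{j ≤ d} aⱼ`. This sum
contains `1 + z_k` for each `k`, hence is smaller than its value at `z = 1` by a multiple of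
`|θ|²`, and so is the growth rate of `aₙ`.

*Pointwise convergence* (`tendsto_evalCoeff`): since
`C = (1 - t) / (1 - 2 t - (1 - t) ∑ (z_k - 1) t^k)`, the denominator is a small perturbation of
`1 - 2 t` for `z` near `1`. Instead of its root near `1/2`, the argument uses the explicit
`τ = ½ exp(-i m·θ + θ 𝓗 θᵀ / 2)`, for which the denominator is `o(|θ|²)` (`isLittleO_defect`); this
is where the mean and the Hessian come from. A combination of consecutive `aⱼ τ^j`, close to
`aⱼ τ^j` itself, then changes by only `o(1 / n)` per step (`almostInvariant_succ`), so `aₙ τⁿ`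
stays close to its value at `n = d`, which tends to `1/2`.

Comparing the two facts along rays shows that `𝓗` is positive definite (`posDef_hess`). As `𝓗` is
a diagonal matrix times a rank two perturbation of the identity, its determinant is that of a
`2 × 2` matrix (`det_hess_eq_prod_mean`), and `Aₙ` is `2ⁿ⁻¹ (2πn)^{-d/2} / √det 𝓗` (`A_eq`).
The claim on the maximum follows by evaluating the local limit theorem at a lattice point next to
`n m`.
-/

namespace CompositionLCLT

/-! ### Compositions and the recurrence for the coefficients -/

/-- The weight of the summand `j + 1` in a composition: the variable `z_{j+1}` if `j + 1 ≤ d`,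
and `1` otherwise. -/
noncomputable def partWeight (d j : ℕ) : Poly d :=
  if h : j < d then MvPolynomial.X ⟨j, h⟩ else 1

theorem oneDivOneSub_eq_mk (d : ℕ) : oneDivOneSub d = PowerSeries.mk 1 := by
  have h1 := one_sub_mul_oneDivOneSub d
  have h2 := PowerSeries.mk_one_mul_one_sub_eq_one (Poly d)
  calc oneDivOneSub d = (PowerSeries.mk 1 * (1 - PowerSeries.X)) * oneDivOneSub d := by
        rw [h2, one_mul]
    _ = PowerSeries.mk 1 := by rw [mul_assoc, h1, mul_one]

theorem coeff_zero_denom (d : ℕ) : PowerSeries.coeff 0 (denom d) = 1 := by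
  simp [denom]

theorem coeff_succ_denom (d j : ℕ) :
    PowerSeries.coeff (j + 1) (denom d) = -partWeight d j := by
  have h1 : ∀ k : Fin d, PowerSeries.coeff (j + 1)
      (PowerSeries.C (MvPolynomial.X k : Poly d) * PowerSeries.X ^ ((k : ℕ) + 1))
      = if j = k then MvPolynomial.X k else 0 := by
    intro k
    rw [PowerSeries.coeff_C_mul, PowerSeries.coeff_X_pow]
    simp
  have h2 : PowerSeries.coeff (j + 1) (PowerSeries.X ^ (d + 1) * oneDivOneSub d)
      = if d ≤ j then (1 : Poly d) else 0 := by
    rw [PowerSeries.coeff_X_pow_mul', oneDivOneSub_eq_mk]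
    simp
  rw [denom, map_sub, map_sub, map_sum, h2, Finset.sum_congr rfl fun k _ => h1 k, partWeight]
  by_cases hj : j < d
  · have : ∀ k : Fin d, (j = (k : ℕ)) ↔ (⟨j, hj⟩ : Fin d) = k := by
      intro k; rw [Fin.ext_iff]
    simp [this, hj, PowerSeries.coeff_one]
  · have : ∀ k : Fin d, ¬ (j = (k : ℕ)) := fun k hk => hj (hk ▸ k.2)
    simp [this, hj, PowerSeries.coeff_one]

theorem coeff_zero_genFun (d : ℕ) : PowerSeries.coeff 0 (genFun d) = 1 := by
  have := congrArg (PowerSeries.coeff 0) (denom_mul_genFun d)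
  simpa [PowerSeries.coeff_mul, coeff_zero_denom, denom] using this

theorem coeff_succ_genFun (d n : ℕ) :
    PowerSeries.coeff (n + 1) (genFun d)
      = ∑ j ∈ Finset.range (n + 1), partWeight d j * PowerSeries.coeff (n - j) (genFun d) := by
  have h := congrArg (PowerSeries.coeff (n + 1)) (denom_mul_genFun d)
  rw [PowerSeries.coeff_mul, Finset.Nat.sum_antidiagonal_eq_sum_range_succ_mk,
    Finset.sum_range_succ'] at h
  simp only [coeff_succ_denom, coeff_zero_denom, PowerSeries.coeff_one, Nat.succ_ne_zero,
    if_false, Nat.sub_zero, one_mul, neg_mul, Finset.sum_neg_distrib, Nat.add_sub_add_right] at h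
  linear_combination h

theorem headI_blocks_cons_tail_blocks {n : ℕ} (c : Composition (n + 1)) :
    c.blocks.headI :: c.blocks.tail = c.blocks := by
  have h := c.blocks_sum
  rcases hb : c.blocks with _ | ⟨x, l⟩
  · rw [hb] at h; simp at h
  · rfl

theorem headI_blocks_pos {n : ℕ} (c : Composition (n + 1)) : 0 < c.blocks.headI :=
  c.blocks_pos (by rw [← headI_blocks_cons_tail_blocks c]; simp)

theorem headI_blocks_add_sum_tail_blocks {n : ℕ} (c : Composition (n + 1)) :
    c.blocks.headI + c.blocks.tail.sum = n + 1 := by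
  rw [← List.sum_cons, headI_blocks_cons_tail_blocks, c.blocks_sum]

/-- A composition of `n + 1` is a first summand `k + 1` followed by a composition of `n - k`. -/
def compositionSuccEquiv (n : ℕ) :
    Composition (n + 1) ≃ (Σ k : Fin (n + 1), Composition (n - k)) where
  toFun c := ⟨⟨c.blocks.headI - 1, by
      have := headI_blocks_add_sum_tail_blocks c
      omega⟩,
    ⟨c.blocks.tail, fun h => c.blocks_pos (List.mem_of_mem_tail h), by
      have := headI_blocks_add_sum_tail_blocks c
      have := headI_blocks_pos c
      simp only
      omega⟩⟩
  invFun p := ⟨(p.1 + 1) :: p.2.blocks, by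
      intro i hi
      rcases List.mem_cons.1 hi with rfl | h
      · omega
      · exact p.2.blocks_pos h, by
      have := p.1.2
      simp [p.2.blocks_sum]; omega⟩
  left_inv c := by
    apply Composition.ext
    have := headI_blocks_pos c
    simp only
    rw [Nat.sub_add_cancel this, headI_blocks_cons_tail_blocks]
  right_inv p := by
    rcases p with ⟨k, c⟩
    rfl

theorem sum_composition_weight (d n : ℕ) :
    ∑ c : Composition n, (c.blocks.map fun k => partWeight d (k - 1)).prod
      = PowerSeries.coeff n (genFun d) := by
  induction n using Nat.strong_induction_on with
  | _ n ih =>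
    rcases n with _ | n
    · have : (default : Composition 0).blocks = [] := by
        rw [Composition.blocks_eq_nil]
      rw [coeff_zero_genFun, Fintype.sum_eq_single default]
      · simp [this]
      · intro c hc
        refine absurd (Composition.ext ?_) hc
        rw [this, Composition.blocks_eq_nil]
    · rw [coeff_succ_genFun, ← (compositionSuccEquiv n).symm.sum_comp, Fintype.sum_sigma,
        Finset.sum_range]
      refine Finset.sum_congr rfl fun k _ => ?_
      rw [← ih (n - k) (by omega), Finset.mul_sum]
      refine Finset.sum_congr rfl fun c _ => ?_
      simp [compositionSuccEquiv]

/-- The vector of the numbers of occurrences of `1, …, d` in a list. -/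
noncomputable def occurrences (d : ℕ) (l : List ℕ) : Fin d →₀ ℕ :=
  Finsupp.equivFunOnFinite.symm fun k => l.count ((k : ℕ) + 1)

theorem prod_partWeight (d : ℕ) (l : List ℕ) (hl : ∀ k ∈ l, 0 < k) :
    (l.map fun k => partWeight d (k - 1)).prod = MvPolynomial.monomial (occurrences d l) 1 := by
  induction l with
  | nil =>
    have : occurrences d [] = 0 := by ext; simp [occurrences]
    simp [this]
  | cons x l ih =>
    have hx : 0 < x := hl x (by simp)
    rw [List.map_cons, List.prod_cons, ih fun k hk => hl k (by simp [hk]), partWeight]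
    split_ifs with h
    · have : Finsupp.single ⟨x - 1, h⟩ 1 + occurrences d l = occurrences d (x :: l) := by
        ext k
        have e : ((⟨x - 1, h⟩ : Fin d) = k) ↔ x = (k : ℕ) + 1 := by
          rw [Fin.ext_iff]; simp only; omega
        simp only [Finsupp.add_apply, occurrences, Finsupp.equivFunOnFinite_symm_apply_apply,
          List.count_cons, Finsupp.single_apply, e, beq_iff_eq]
        rw [add_comm]
      rw [MvPolynomial.X, MvPolynomial.monomial_mul, one_mul, this]
    · have : occurrences d l = occurrences d (x :: l) := by
        ext k
        have := k.2
        simp only [occurrences, Finsupp.equivFunOnFinite_symm_apply_apply, List.count_cons,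
          beq_iff_eq]
        rw [if_neg (by omega), add_zero]
      rw [one_mul, this]

theorem coeffC_eq_numCompositions (d n : ℕ) (s : Fin d →₀ ℕ) :
    coeffC d n s = (numCompositions d n s : ℝ) := by
  classical
  have h : ∀ c : Composition n, occurrences d c.blocks = s ↔
      ∀ k : Fin d, c.blocks.count ((k : ℕ) + 1) = s k := by
    intro c
    rw [Finsupp.ext_iff]
    rfl
  rw [coeffC, ← sum_composition_weight, MvPolynomial.coeff_sum, numCompositions,
    Nat.card_eq_fintype_card, Fintype.card_subtype]
  simp_rw [prod_partWeight d _ fun k hk => Composition.blocks_pos _ hk,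
    MvPolynomial.coeff_monomial, h, Finset.sum_boole]

variable {d : ℕ}

/-! ### The polynomials `[tⁿ] C(z, t)` on the unit torus: uniform decay -/

/-- The value of the weight of the summand `j + 1` at the point `z ∈ ℂ^d`. -/
def weight (z : Fin d → ℂ) (j : ℕ) : ℂ :=
  if h : j < d then z ⟨j, h⟩ else 1

/-- The value of the polynomial `[tⁿ] C(z, t)` at the point `z ∈ ℂ^d`. -/
noncomputable def evalCoeff (z : Fin d → ℂ) (n : ℕ) : ℂ :=
  MvPolynomial.aeval z (PowerSeries.coeff n (genFun d))

theorem weight_of_lt (z : Fin d → ℂ) (k : Fin d) : weight z k = z k := by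
  simp [weight]

theorem weight_of_le (z : Fin d → ℂ) {j : ℕ} (hj : d ≤ j) : weight z j = 1 := by
  simp [weight, hj]

theorem norm_weight_le {z : Fin d → ℂ} (hz : ∀ k, ‖z k‖ ≤ 1) (j : ℕ) : ‖weight z j‖ ≤ 1 := by
  unfold weight
  split_ifs
  · exact hz _
  · simp

theorem evalCoeff_zero (z : Fin d → ℂ) : evalCoeff z 0 = 1 := by
  rw [evalCoeff, coeff_zero_genFun, map_one]

theorem evalCoeff_succ (z : Fin d → ℂ) (n : ℕ) :
    evalCoeff z (n + 1) = ∑ j ∈ Finset.range (n + 1), weight z j * evalCoeff z (n - j) := by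
  rw [evalCoeff, coeff_succ_genFun, map_sum]
  refine Finset.sum_congr rfl fun j _ => ?_
  rw [map_mul, evalCoeff, partWeight, weight]
  split_ifs <;> simp

theorem evalCoeff_succ' (z : Fin d → ℂ) (n : ℕ) :
    evalCoeff z (n + 1) = ∑ j ∈ Finset.range (n + 1), evalCoeff z j * weight z (n - j) := by
  rw [evalCoeff_succ, ← Finset.sum_range_reflect]
  refine Finset.sum_congr rfl fun j hj => ?_
  have : j ≤ n := Nat.lt_succ_iff.1 (Finset.mem_range.1 hj)
  rw [Nat.add_sub_cancel, Nat.sub_sub_self this, mul_comm]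

theorem norm_evalCoeff_succ_le_sum {z : Fin d → ℂ} (hz : ∀ k, ‖z k‖ ≤ 1) (n : ℕ) :
    ‖evalCoeff z (n + 1)‖ ≤ ∑ j ∈ Finset.range (n + 1), ‖evalCoeff z j‖ := by
  rw [evalCoeff_succ']
  refine norm_sum_le_of_le _ fun j _ => ?_
  rw [norm_mul]
  exact mul_le_of_le_one_right (norm_nonneg _) (norm_weight_le hz _)

theorem sum_norm_evalCoeff_le {z : Fin d → ℂ} (hz : ∀ k, ‖z k‖ ≤ 1) (n : ℕ) :
    ∑ j ∈ Finset.range (n + 1), ‖evalCoeff z j‖ ≤ 2 ^ n := by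
  induction n with
  | zero => simp [evalCoeff_zero]
  | succ n ih =>
    rw [Finset.sum_range_succ, pow_succ]
    linarith [norm_evalCoeff_succ_le_sum hz n]

theorem norm_evalCoeff_succ_le {z : Fin d → ℂ} (hz : ∀ k, ‖z k‖ ≤ 1) (n : ℕ) :
    ‖evalCoeff z (n + 1)‖ ≤ 2 ^ n :=
  (norm_evalCoeff_succ_le_sum hz n).trans (sum_norm_evalCoeff_le hz n)

theorem norm_evalCoeff_le {z : Fin d → ℂ} (hz : ∀ k, ‖z k‖ ≤ 1) (n : ℕ) :
    ‖evalCoeff z n‖ ≤ 2 ^ n :=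
  (Finset.single_le_sum (f := fun j => ‖evalCoeff z j‖) (fun _ _ => norm_nonneg _)
    (Finset.self_mem_range_succ n)).trans (sum_norm_evalCoeff_le hz n)

/-- Decomposition of a composition at the first partial sum exceeding `t`: the summand that
crosses `t` starts at the partial sum `j` and ends at the partial sum `t + 1 + m`. -/
theorem evalCoeff_eq_sum_crossing (z : Fin d → ℂ) (t r : ℕ) :
    evalCoeff z (t + 1 + r) = ∑ m ∈ Finset.range (r + 1),
      (∑ j ∈ Finset.range (t + 1), evalCoeff z j * weight z (t + m - j)) * evalCoeff z (r - m) := by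
  induction t generalizing r with
  | zero =>
    rw [Nat.zero_add, Nat.add_comm 1 r, evalCoeff_succ]
    simp [evalCoeff_zero]
  | succ t ih =>
    have h1 := ih (r + 1)
    simp only [Finset.sum_range_succ' _ (r + 1), Nat.add_zero, ← evalCoeff_succ', Nat.sub_zero,
      Nat.add_sub_add_right] at h1
    rw [evalCoeff_succ z r, Finset.mul_sum, ← Finset.sum_add_distrib] at h1
    rw [show t + 1 + 1 + r = t + 1 + (r + 1) by ring, h1]
    refine Finset.sum_congr rfl fun m _ => ?_
    rw [Finset.sum_range_succ _ (t + 1), Nat.add_sub_cancel_left,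
      show t + (m + 1) = t + 1 + m by ring]
    ring

theorem norm_one_add_exp_mul_I_le {x : ℝ} (hx : |x| ≤ Real.pi) :
    ‖1 + Complex.exp (x * Complex.I)‖ ≤ 2 - x ^ 2 / Real.pi ^ 2 := by
  have hpi := Real.pi_pos
  have h2 : x ^ 2 / Real.pi ^ 2 ≤ 1 := by
    rw [div_le_one (by positivity)]
    exact sq_le_sq' (neg_le_of_abs_le hx) (le_of_abs_le hx)
  have h1 : ‖1 + Complex.exp (x * Complex.I)‖ ^ 2 = 2 + 2 * Real.cos x := by
    rw [← Complex.normSq_eq_norm_sq, Complex.normSq_apply]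
    simp only [Complex.add_re, Complex.one_re, Complex.exp_ofReal_mul_I_re, Complex.add_im,
      Complex.one_im, Complex.exp_ofReal_mul_I_im]
    nlinarith [Real.sin_sq_add_cos_sq x]
  have h3 := Real.cos_le_one_sub_mul_cos_sq hx
  refine abs_le_of_sq_le_sq' ?_ (by linarith) |>.2
  have h4 : Real.cos x ≤ 1 - 2 * (x ^ 2 / Real.pi ^ 2) := by
    convert h3 using 1; ring
  rw [h1]
  nlinarith [sq_nonneg (x ^ 2 / Real.pi ^ 2)]

/-- Among the compositions of the numbers `0, …, d` the empty one and the one-summand composition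
`k` have weights `1` and `z_k`, which cancel in part when `z_k ≠ 1`. -/
theorem norm_sum_evalCoeff_le_of_coord {z : Fin d → ℂ} (hz : ∀ k, ‖z k‖ ≤ 1) (k : Fin d) :
    ‖∑ j ∈ Finset.range (d + 1), evalCoeff z j‖ ≤ ‖1 + z k‖ + (2 ^ d - 2) := by
  have hgeom : ∀ n : ℕ, ∑ j ∈ Finset.range n, (2 : ℝ) ^ j = 2 ^ n - 1 := fun n => by
    rw [geom_sum_eq (by norm_num)]; norm_num
  have hk : evalCoeff z (k + 1) = z k + ∑ j ∈ Finset.range k, evalCoeff z (j + 1) *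
      weight z (k - (j + 1)) := by
    rw [evalCoeff_succ', Finset.sum_range_succ', evalCoeff_zero, Nat.sub_zero, weight_of_lt]
    ring
  have hmem : (k : ℕ) ∈ Finset.range d := Finset.mem_range.2 k.2
  rw [Finset.sum_range_succ', evalCoeff_zero, ← Finset.add_sum_erase _ _ hmem, hk]
  have e1 : ‖∑ j ∈ Finset.range k, evalCoeff z (j + 1) * weight z (k - (j + 1))‖
      ≤ 2 ^ (k : ℕ) - 1 := by
    rw [← hgeom]
    refine norm_sum_le_of_le _ fun j _ => ?_
    rw [norm_mul]
    exact (mul_le_of_le_one_right (norm_nonneg _) (norm_weight_le hz _)).trans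
      (norm_evalCoeff_succ_le hz j)
  have e2 : ‖∑ j ∈ (Finset.range d).erase k, evalCoeff z (j + 1)‖ ≤ 2 ^ d - 1 - 2 ^ (k : ℕ) := by
    rw [← hgeom, ← Finset.add_sum_erase _ _ hmem, add_sub_cancel_left]
    exact norm_sum_le_of_le _ fun j _ => norm_evalCoeff_succ_le hz j
  calc _ = ‖(1 + z k) + ∑ j ∈ Finset.range k, evalCoeff z (j + 1) * weight z (k - (j + 1))
          + ∑ j ∈ (Finset.range d).erase k, evalCoeff z (j + 1)‖ := by congr 1; ring
    _ ≤ _ := norm_add₃_le.trans (by linarith)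

/-- The point `(e^{iθ₁}, …, e^{iθ_d})` of the torus. -/
noncomputable def torusPoint (θ : Fin d → ℝ) : Fin d → ℂ :=
  fun k => Complex.exp (θ k * Complex.I)

theorem norm_torusPoint_le (θ : Fin d → ℝ) (k : Fin d) : ‖torusPoint θ k‖ ≤ 1 :=
  (Complex.norm_exp_ofReal_mul_I _).le

theorem norm_sum_evalCoeff_torusPoint_le (hd : 1 ≤ d) {θ : Fin d → ℝ}
    (hθ : ∀ k, |θ k| ≤ Real.pi) :
    ‖∑ j ∈ Finset.range (d + 1), evalCoeff (torusPoint θ) j‖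
      ≤ 2 ^ d - (∑ k, θ k ^ 2) / (d * Real.pi ^ 2) := by
  have h : ∀ k ∈ (Finset.univ : Finset (Fin d)), θ k ^ 2 / Real.pi ^ 2
      ≤ 2 ^ d - ‖∑ j ∈ Finset.range (d + 1), evalCoeff (torusPoint θ) j‖ := fun k _ => by
    have h1 := norm_sum_evalCoeff_le_of_coord (norm_torusPoint_le θ) k
    have h2 := norm_one_add_exp_mul_I_le (hθ k)
    unfold torusPoint at *
    linarith
  have h3 := Finset.sum_le_card_nsmul _ _ _ h
  rw [Finset.card_univ, Fintype.card_fin, nsmul_eq_mul, ← Finset.sum_div] at h3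
  have hd' : (0 : ℝ) < d := by exact_mod_cast hd
  have : (∑ k, θ k ^ 2) / (d * Real.pi ^ 2) = (∑ k, θ k ^ 2) / Real.pi ^ 2 / d := by
    rw [div_div, mul_comm]
  rw [this]
  have h4 : (∑ k, θ k ^ 2) / Real.pi ^ 2 / d ≤ _ := (div_le_iff₀' hd').2 h3
  linarith

/-- If the sum of the `[t^j] C(z, t)`, `j ≤ d`, misses its largest possible modulus `2^d` by `δ`,
then the exponential growth rate of `[tⁿ] C(z, t)` is smaller than `2` by a margin
proportional to `δ`. -/
theorem norm_evalCoeff_mul_pow_le {z : Fin d → ℂ} (hz : ∀ k, ‖z k‖ ≤ 1) {δ y : ℝ}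
    (hδ1 : δ ≤ 1) (hδ : ‖∑ j ∈ Finset.range (d + 1), evalCoeff z j‖ ≤ 2 ^ d - δ)
    (hy0 : 0 ≤ y) (hy : (2 * d + 4) * y = δ / 4 ^ d / 2) (n : ℕ) :
    ‖evalCoeff z n‖ * ((1 + y) / 2) ^ n ≤ (1 + y) ^ d := by
  set x := (1 + y) / 2 with hx
  have hδ0 : 0 ≤ δ := by
    have : 0 ≤ δ / 4 ^ d / 2 := by rw [← hy]; positivity
    by_contra! hneg
    have : δ / 4 ^ d / 2 < 0 := by
      rw [div_div]; exact div_neg_of_neg_of_pos hneg (by positivity)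
    linarith
  have hη1 : δ / 4 ^ d / 2 ≤ 1 / 2 := by
    have : δ / 4 ^ d ≤ 1 := div_le_one_of_le₀ (hδ1.trans (one_le_pow₀ (by norm_num))) (by positivity)
    linarith
  have hdy : (d + 1) * y ≤ 1 := by nlinarith
  have hdy0 : 0 ≤ (d : ℝ) * y := by positivity
  have hy1 : y ≤ 1 / 4 := by nlinarith
  have hx0 : 0 < x := by rw [hx]; positivity
  have hx1 : x < 1 := by rw [hx]; linarith
  -- The generating function of the crossing weights at `x` is at most `1`.
  have key : 2 ^ d * x ^ (d + 1) * (1 - x)⁻¹ - δ * x ^ (2 * d + 1) ≤ 1 := by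
    have h1 : (1 + y) ^ (d + 1) ≤ 1 + 2 * ((d + 1) * y) := by
      have e1 : (1 + y) ^ (d + 1) ≤ Real.exp ((d + 1) * y) := by
        have := Real.add_one_le_exp y
        calc (1 + y) ^ (d + 1) ≤ Real.exp y ^ (d + 1) := by gcongr; linarith
          _ = Real.exp ((d + 1) * y) := by rw [← Real.exp_nat_mul]; push_cast; rfl
      have e2 := Real.abs_exp_sub_one_le (x := (d + 1) * y) (by
        rw [abs_of_nonneg (by positivity)]; exact hdy)
      rw [abs_of_nonneg (a := (d + 1) * y) (by positivity)] at e2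
      linarith [(abs_le.1 e2).2]
    have h2 : (1 / 2 : ℝ) ^ (2 * d + 1) ≤ x ^ (2 * d + 1) := by
      gcongr; rw [hx]; linarith
    have h3 : (1 / 2 : ℝ) ^ (2 * d + 1) = 1 / 4 ^ d / 2 := by
      rw [pow_succ, pow_mul, show (1 / 2 : ℝ) ^ 2 = 1 / 4 by norm_num, one_div_pow]; ring
    have h4 : δ / 4 ^ d / 2 ≤ δ * x ^ (2 * d + 1) := by
      calc δ / 4 ^ d / 2 = δ * (1 / 2 : ℝ) ^ (2 * d + 1) := by rw [h3]; ring
        _ ≤ _ := by gcongr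
    have h5 : 2 ^ d * x ^ (d + 1) = (1 + y) ^ (d + 1) / 2 := by
      rw [hx, div_pow, pow_succ (2 : ℝ)]; field_simp
    rw [h5]
    have h6 : (1 + y) ^ (d + 1) / 2 * (1 - x)⁻¹ ≤ 1 + δ / 4 ^ d / 2 := by
      rw [← div_eq_mul_inv, div_le_iff₀ (by linarith)]
      have : (1 - x) = (1 - y) / 2 := by rw [hx]; ring
      rw [this]
      have h7 : 1 + 2 * ((d + 1) * y) ≤ (1 + (2 * d + 4) * y) * (1 - y) := by nlinarith
      rw [← hy]
      linarith
    linarith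
  have hy1' : 1 ≤ 1 + y := by linarith
  induction n using Nat.strong_induction_on with
  | _ n ih =>
    by_cases hn : n ≤ d
    · calc ‖evalCoeff z n‖ * x ^ n ≤ 2 ^ n * x ^ n := by
            gcongr; exact norm_evalCoeff_le hz n
        _ = (1 + y) ^ n := by rw [← mul_pow, hx]; congr 1; ring
        _ ≤ (1 + y) ^ d := pow_le_pow_right₀ hy1' hn
    · obtain ⟨r, rfl⟩ : ∃ r, n = d + 1 + r := ⟨n - (d + 1), by omega⟩
      -- Bounds for the crossing weights. All saving is taken from `m = d`, the first index at which
      -- the crossing summand exceeds `d` whatever its start, so that it carries no variable.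
      let γ : ℕ → ℝ := fun m => 2 ^ d - if m = d then δ else 0
      have hγ0 : ∀ m, 0 ≤ γ m := fun m => by
        have : (1 : ℝ) ≤ 2 ^ d := one_le_pow₀ (by norm_num)
        simp only [γ]; split_ifs <;> linarith
      have hγ : ∀ m, ‖∑ j ∈ Finset.range (d + 1), evalCoeff z j * weight z (d + m - j)‖ ≤ γ m := by
        intro m
        simp only [γ]
        split_ifs with hm
        · rw [Finset.sum_congr rfl fun j hj => by
            rw [weight_of_le z (by have := Finset.mem_range.1 hj; omega), mul_one]]
          exact hδ
        · rw [sub_zero]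
          refine le_trans (norm_sum_le_of_le _ fun j _ => ?_) (sum_norm_evalCoeff_le hz d)
          rw [norm_mul]
          exact mul_le_of_le_one_right (norm_nonneg _) (norm_weight_le hz _)
      have hsum : ∑ m ∈ Finset.range (r + 1), γ m * x ^ (d + 1 + m) ≤ 1 := by
        calc ∑ m ∈ Finset.range (r + 1), γ m * x ^ (d + 1 + m)
            ≤ ∑ m ∈ Finset.range (r + 1 + d), γ m * x ^ (d + 1 + m) :=
              Finset.sum_le_sum_of_subset_of_nonneg
                (Finset.range_subset_range.2 (by omega))
                fun m _ _ => mul_nonneg (hγ0 m) (by positivity)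
          _ = 2 ^ d * x ^ (d + 1) * (∑ m ∈ Finset.range (r + 1 + d), x ^ m)
                - δ * x ^ (2 * d + 1) := by
              simp only [γ, sub_mul, Finset.sum_sub_distrib, ite_mul, zero_mul]
              rw [Finset.sum_ite_eq' , if_pos (Finset.mem_range.2 (by omega)), Finset.mul_sum,
                show d + 1 + d = 2 * d + 1 by ring]
              congr 1
              exact Finset.sum_congr rfl fun m _ => by rw [pow_add]; ring
          _ ≤ 2 ^ d * x ^ (d + 1) * (1 - x)⁻¹ - δ * x ^ (2 * d + 1) := by
              gcongr
              rw [geom_sum_eq hx1.ne, ← neg_div_neg_eq, ← one_div]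
              have := pow_pos hx0 (r + 1 + d)
              gcongr <;> linarith
          _ ≤ 1 := key
      rw [evalCoeff_eq_sum_crossing]
      calc _ ≤ (∑ m ∈ Finset.range (r + 1), γ m * ‖evalCoeff z (r - m)‖) * x ^ (d + 1 + r) := by
            gcongr
            refine norm_sum_le_of_le _ fun m _ => ?_
            rw [norm_mul]
            gcongr
            exact hγ m
        _ ≤ ∑ m ∈ Finset.range (r + 1), γ m * x ^ (d + 1 + m) * (1 + y) ^ d := by
            rw [Finset.sum_mul]
            refine Finset.sum_le_sum fun m hm => ?_
            have hmr : m ≤ r := Nat.lt_succ_iff.1 (Finset.mem_range.1 hm)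
            have e : x ^ (d + 1 + r) = x ^ (d + 1 + m) * x ^ (r - m) := by
              rw [← pow_add]; congr 1; omega
            have := ih (r - m) (by omega)
            calc _ = γ m * x ^ (d + 1 + m) * (‖evalCoeff z (r - m)‖ * x ^ (r - m)) := by
                  rw [e]; ring
              _ ≤ _ := mul_le_mul_of_nonneg_left this (mul_nonneg (hγ0 m) (by positivity))
        _ ≤ (1 + y) ^ d := by
            rw [← Finset.sum_mul]
            exact mul_le_of_le_one_left (by positivity) hsum

/-- The rate in the Gaussian bound for `[tⁿ] C(z, t)` on the torus. -/
noncomputable def decayRate (d : ℕ) : ℝ := 1 / (4 * (2 * d + 4) * 4 ^ d * (d * Real.pi ^ 2))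

theorem decayRate_pos (hd : 1 ≤ d) : 0 < decayRate d := by
  have hd' : (0 : ℝ) < d := by exact_mod_cast hd
  unfold decayRate
  positivity

theorem norm_evalCoeff_torusPoint_le (hd : 1 ≤ d) {θ : Fin d → ℝ}
    (hθ : ∀ k, |θ k| ≤ Real.pi) (n : ℕ) :
    ‖evalCoeff (torusPoint θ) n‖
      ≤ 2 ^ n * (2 ^ d * Real.exp (-decayRate d * (n * ∑ k, θ k ^ 2))) := by
  have hd' : (0 : ℝ) < d := by exact_mod_cast hd
  have hpi := Real.pi_pos
  set δ := (∑ k, θ k ^ 2) / (d * Real.pi ^ 2) with hδ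
  have hδ0 : 0 ≤ δ := by positivity
  have hδ1 : δ ≤ 1 := by
    rw [hδ, div_le_one (by positivity)]
    have := Finset.sum_le_card_nsmul Finset.univ (fun k => θ k ^ 2) (Real.pi ^ 2)
      fun k _ => sq_le_sq' (neg_le_of_abs_le (hθ k)) (le_of_abs_le (hθ k))
    simpa using this
  set y := δ / 4 ^ d / 2 / (2 * d + 4) with hy
  have hy0 : 0 ≤ y := by positivity
  have hy1 : y ≤ 1 := by
    have h4 : (1 : ℝ) ≤ 4 ^ d := one_le_pow₀ (by norm_num)
    rw [hy, div_div, div_div]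
    refine div_le_one_of_le₀ (hδ1.trans ?_) (by positivity)
    have : (1 : ℝ) ≤ 2 * (2 * d + 4) := by linarith
    nlinarith
  have hyc : y / 2 = decayRate d * ∑ k, θ k ^ 2 := by
    rw [hy, hδ, decayRate]; field_simp; norm_num
  have h := norm_evalCoeff_mul_pow_le (norm_torusPoint_le θ) hδ1
    (norm_sum_evalCoeff_torusPoint_le hd hθ) hy0 (by rw [hy]; field_simp) n
  have hexp : Real.exp (y / 2) ≤ 1 + y := by
    have := Real.abs_exp_sub_one_le (x := y / 2) (by rw [abs_of_nonneg (by positivity)]; linarith)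
    rw [abs_of_nonneg (a := y / 2) (by positivity)] at this
    linarith [(abs_le.1 this).2]
  have h2 : ((1 + y) / 2) ^ n ≥ (Real.exp (y / 2) / 2) ^ n := by gcongr
  have h3 : ‖evalCoeff (torusPoint θ) n‖ * (Real.exp (y / 2) / 2) ^ n ≤ 2 ^ d :=
    calc _ ≤ ‖evalCoeff (torusPoint θ) n‖ * ((1 + y) / 2) ^ n := by gcongr
      _ ≤ (1 + y) ^ d := h
      _ ≤ 2 ^ d := by gcongr; linarith
  have h4 : (Real.exp (y / 2) / 2) ^ n = Real.exp (n * (y / 2)) / 2 ^ n := by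
    rw [div_pow, Real.exp_nat_mul]
  rw [h4, ← le_div_iff₀ (by positivity)] at h3
  refine h3.trans (le_of_eq ?_)
  rw [show -decayRate d * (n * ∑ k, θ k ^ 2) = -(n * (y / 2)) by rw [hyc]; ring, Real.exp_neg]
  field_simp

/-! ### The Hessian as a quadratic form -/

theorem hess_apply (i j : Fin d) :
    hess d i j = (if i = j then mean d i else 0) - ((i : ℝ) + j - 1) * (mean d i * mean d j) := by
  have hz : ∀ k : Fin d, mean d k = (2 : ℝ) ^ (-((k : ℤ) + 2)) := by
    intro k
    rw [mean, zpow_neg, one_div]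
    norm_cast
  simp only [hess, Matrix.of_apply, hessEntry, Nat.add_right_cancel_iff, ← Fin.ext_iff]
  split_ifs with h
  · subst h
    rw [hz, ← zpow_add₀ (by norm_num), mul_add, mul_sub, ← zpow_natCast, ← zpow_add₀ (by norm_num)]
    push_cast
    rw [show -2 * ((i : ℤ) + 1 + 1) + (i + 1 + 1) = -((i : ℤ) + 2) by ring,
      show -2 * ((i : ℤ) + 1 + 1) = -((i : ℤ) + 2) + -((i : ℤ) + 2) by ring]
    ring
  · rw [hz, hz, ← zpow_add₀ (by norm_num)]
    push_cast
    rw [show -((i : ℤ) + 1) - (j + 1) - 2 = -((i : ℤ) + 2) + -((j : ℤ) + 2) by ring]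
    ring

/-- The quadratic form `u ↦ u 𝓗 uᵀ` of the Hessian. -/
noncomputable def hessForm (u : Fin d → ℝ) : ℝ := u ⬝ᵥ hess d *ᵥ u

theorem hessForm_eq (u : Fin d → ℝ) :
    hessForm u = ∑ k, mean d k * u k ^ 2 + (mean d ⬝ᵥ u) ^ 2
      - 2 * (mean d ⬝ᵥ u) * ∑ k : Fin d, (k : ℝ) * (mean d k * u k) := by
  have h1 : hessForm u = ∑ i, ∑ j, ((if i = j then mean d i * u i ^ 2 else 0)
      - (i : ℝ) * (mean d i * u i) * (mean d j * u j)
      - (mean d i * u i) * ((j : ℝ) * (mean d j * u j))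
      + (mean d i * u i) * (mean d j * u j)) := by
    simp only [hessForm, dotProduct, Matrix.mulVec, Finset.mul_sum]
    refine Finset.sum_congr rfl fun i _ => Finset.sum_congr rfl fun j _ => ?_
    rw [hess_apply]
    split_ifs with h
    · subst h; ring
    · ring
  rw [h1]
  simp only [Finset.sum_add_distrib, Finset.sum_sub_distrib, ← Finset.mul_sum, ← Finset.sum_mul,
    Finset.sum_ite_eq, Finset.mem_univ, if_true, dotProduct]
  ring

/-! ### Second order expansions at the origin -/

/-- `f x = a + b x + c x² + o(x²)` as `x → 0` in `ℝ`. -/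
def HasQuadExpansion (f : ℝ → ℂ) (a b c : ℂ) : Prop :=
  (fun x : ℝ => f x - (a + b * x + c * x ^ 2)) =o[𝓝 0] fun x : ℝ => x ^ 2

namespace HasQuadExpansion

variable {f g : ℝ → ℂ} {a b c a' b' c' : ℂ}

theorem const (a : ℂ) : HasQuadExpansion (fun _ => a) a 0 0 := by
  simp [HasQuadExpansion]

theorem add (hf : HasQuadExpansion f a b c) (hg : HasQuadExpansion g a' b' c') :
    HasQuadExpansion (fun x => f x + g x) (a + a') (b + b') (c + c') :=
  (Asymptotics.IsLittleO.add hf hg).congr_left fun x => by ring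

theorem sub (hf : HasQuadExpansion f a b c) (hg : HasQuadExpansion g a' b' c') :
    HasQuadExpansion (fun x => f x - g x) (a - a') (b - b') (c - c') :=
  (Asymptotics.IsLittleO.sub hf hg).congr_left fun x => by ring

theorem sum {ι : Type*} (s : Finset ι) {f : ι → ℝ → ℂ} {a b c : ι → ℂ}
    (h : ∀ i ∈ s, HasQuadExpansion (f i) (a i) (b i) (c i)) :
    HasQuadExpansion (fun x => ∑ i ∈ s, f i x) (∑ i ∈ s, a i) (∑ i ∈ s, b i) (∑ i ∈ s, c i) :=
  (Asymptotics.IsLittleO.sum h).congr_left fun x => by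
    simp only [Finset.sum_apply, Finset.sum_sub_distrib, Finset.sum_add_distrib, Finset.sum_mul]

theorem isBigO_one_of_continuous {p : ℝ → ℂ} (hp : Continuous p) :
    p =O[𝓝 0] fun _ => (1 : ℝ) :=
  (hp.tendsto 0).isBigO_one ℝ

theorem isLittleO_cube_mul {p : ℝ → ℂ} (hp : Continuous p) :
    (fun x : ℝ => (x : ℂ) ^ 3 * p x) =o[𝓝 0] fun x : ℝ => x ^ 2 := by
  have h1 : (fun x : ℝ => (x : ℂ) ^ 3) =o[𝓝 0] fun x : ℝ => x ^ 2 := by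
    have := Asymptotics.isLittleO_pow_pow (𝕜 := ℝ) (show 2 < 3 by norm_num)
    refine Asymptotics.IsLittleO.of_norm_left (this.norm_left.congr_left fun x => ?_)
    simp
  simpa using h1.mul_isBigO (isBigO_one_of_continuous hp)

theorem mul (hf : HasQuadExpansion f a b c) (hg : HasQuadExpansion g a' b' c') :
    HasQuadExpansion (fun x => f x * g x) (a * a') (a * b' + b * a')
      (a * c' + b * b' + c * a') := by
  have hP : Continuous fun x : ℝ => a + b * x + c * (x : ℂ) ^ 2 := by fun_prop
  have hQ : Continuous fun x : ℝ => a' + b' * x + c' * (x : ℂ) ^ 2 := by fun_prop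
  have h1 := (isBigO_one_of_continuous hP).mul_isLittleO hg
  have h2 := hf.mul_isBigO (isBigO_one_of_continuous hQ)
  have h3 : (fun x : ℝ => (f x - (a + b * x + c * x ^ 2)) * (g x - (a' + b' * x + c' * x ^ 2)))
      =o[𝓝 0] fun x : ℝ => x ^ 2 := by
    have hb : (fun x : ℝ => g x - (a' + b' * x + c' * x ^ 2)) =O[𝓝 0] fun _ => (1 : ℝ) :=
      hg.isBigO.trans (((continuous_pow 2).tendsto (0 : ℝ)).isBigO_one ℝ)
    simpa using Asymptotics.IsLittleO.mul_isBigO hf hb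
  have h4 : (fun x : ℝ => (x : ℂ) ^ 3 * (b * c' + c * b' + c * c' * x)) =o[𝓝 0]
      fun x : ℝ => x ^ 2 := isLittleO_cube_mul (by fun_prop)
  simp only [one_mul, mul_one] at h1 h2
  exact (((h1.add h2).add h3).add h4).congr_left fun x => by ring

theorem exp (b c : ℂ) :
    HasQuadExpansion (fun x => Complex.exp (b * x + c * x ^ 2)) 1 b (c + b ^ 2 / 2) := by
  have ht : Tendsto (fun x : ℝ => b * x + c * (x : ℂ) ^ 2) (𝓝 0) (𝓝 0) := by
    have : Continuous fun x : ℝ => b * x + c * (x : ℂ) ^ 2 := by fun_prop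
    simpa using this.tendsto 0
  have h1 := (Complex.exp_sub_sum_range_isBigO_pow 3).comp_tendsto ht
  have h2 : (fun x : ℝ => (b * x + c * (x : ℂ) ^ 2) ^ 3) =o[𝓝 0] fun x : ℝ => x ^ 2 :=
    (isLittleO_cube_mul (p := fun x : ℝ => (b + c * x) ^ 3) (by fun_prop)).congr_left
      fun x => by ring
  have h3 : (fun x : ℝ => (x : ℂ) ^ 3 * (b * c + c ^ 2 / 2 * x)) =o[𝓝 0]
      fun x : ℝ => x ^ 2 := isLittleO_cube_mul (by fun_prop)
  refine ((h1.trans_isLittleO h2).add h3).congr_left fun x => ?_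
  simp [Finset.sum_range_succ]
  ring

theorem congr (hf : HasQuadExpansion f a b c) (hfg : ∀ x, f x = g x) (ha : a = a') (hb : b = b')
    (hc : c = c') : HasQuadExpansion g a' b' c' := by
  subst ha hb hc
  rwa [← funext hfg]

end HasQuadExpansion

/-! ### The approximate dominant singularity -/

/-- An approximation, to second order in `x`, to the solution `t` near `1/2` of
`1 - 2 t - (1 - t) ∑ (z_k - 1) t^k = 0` at the point `z = (e^{i x u₁}, …, e^{i x u_d})`. -/
noncomputable def approxRoot (u : Fin d → ℝ) (x : ℝ) : ℂ :=
  1 / 2 * Complex.exp (-(mean d ⬝ᵥ u : ℝ) * Complex.I * x + (hessForm u / 2 : ℝ) * x ^ 2)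

/-- The negative of `(1 - t) / C(z, t)`, namely `2 t - 1 + (1 - t) ∑ (z_k - 1) t^k`. -/
noncomputable def defect (z : Fin d → ℂ) (t : ℂ) : ℂ :=
  2 * t - 1 + (1 - t) * ∑ k : Fin d, (z k - 1) * t ^ ((k : ℕ) + 1)

/-- The mean vector and the Hessian are exactly the first and second order coefficients for which
the approximate root is a root up to `o(x²)`. -/
theorem isLittleO_defect (u : Fin d → ℝ) :
    (fun x : ℝ => defect (torusPoint (x • u)) (approxRoot u x)) =o[𝓝 0] fun x : ℝ => x ^ 2 := by
  set α := mean d ⬝ᵥ u with hα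
  set q := hessForm u with hq
  have hτ : HasQuadExpansion (approxRoot u) _ _ _ :=
    ((HasQuadExpansion.const (1 / 2)).mul
      (HasQuadExpansion.exp (-(α : ℝ) * Complex.I) ((q / 2 : ℝ) : ℂ)))
  have hpow : ∀ k : ℕ, HasQuadExpansion (fun x => approxRoot u x ^ k) _ _ _ := fun k =>
    ((HasQuadExpansion.const ((1 / 2) ^ k)).mul
      (HasQuadExpansion.exp (k * (-(α : ℝ) * Complex.I)) (k * ((q / 2 : ℝ) : ℂ)))).congr
      (fun x => by
        rw [approxRoot, mul_pow, ← Complex.exp_nat_mul]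
        congr 2; ring) rfl rfl rfl
  have hε : ∀ k : Fin d, HasQuadExpansion (fun x => torusPoint (x • u) k - 1) _ _ _ := fun k =>
    ((HasQuadExpansion.exp (u k * Complex.I) 0).sub (HasQuadExpansion.const 1)).congr
      (fun x => by
        simp only [torusPoint, Pi.smul_apply, smul_eq_mul]
        congr 2; push_cast; ring) rfl rfl rfl
  have hsum := HasQuadExpansion.sum Finset.univ fun k _ => (hε k).mul (hpow ((k : ℕ) + 1))
  have hmain := (((HasQuadExpansion.const 2).mul hτ).sub (HasQuadExpansion.const 1)).add
    (((HasQuadExpansion.const 1).sub hτ).mul hsum)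
  have hm : ∀ k : Fin d, ((1 : ℂ) / 2) ^ ((k : ℕ) + 1) = 2 * (mean d k : ℝ) := fun k => by
    rw [mean]; push_cast; rw [pow_succ (2 : ℂ) ((k : ℕ) + 1), one_div_pow]; field_simp
  have hα' : (α : ℂ) = ∑ k : Fin d, ((mean d k : ℝ) : ℂ) * u k := by
    rw [hα, dotProduct]; push_cast; rfl
  have hq' : (q : ℂ) = ∑ k : Fin d, ((mean d k : ℝ) : ℂ) * u k ^ 2 + (α : ℂ) ^ 2
      - 2 * α * ∑ k : Fin d, (k : ℂ) * (((mean d k : ℝ) : ℂ) * u k) := by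
    rw [hq, hessForm_eq]; push_cast; rfl
  refine (hmain.congr (a' := 0) (b' := 0) (c' := 0) (fun x => rfl) ?_ ?_ ?_).congr_left
    fun x => ?_
  · simp
  · have : ∀ k : Fin d, (u k : ℂ) * Complex.I * ((1 : ℂ) / 2) ^ ((k : ℕ) + 1)
        = 2 * Complex.I * (((mean d k : ℝ) : ℂ) * u k) := fun k => by rw [hm]; ring
    simp only [sub_self, zero_mul, mul_one, zero_add, sub_zero, add_zero, Finset.sum_const_zero,
      this, ← Finset.mul_sum, ← hα', mul_zero]
    ring
  · have : ∀ k : Fin d,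
        (u k : ℂ) * Complex.I * ((1 / 2) ^ ((k : ℕ) + 1) * ((((k : ℕ) + 1 : ℕ) : ℂ) *
          (-(α : ℝ) * Complex.I))) + (u k * Complex.I) ^ 2 / 2 * ((1 / 2) ^ ((k : ℕ) + 1))
        = 2 * α * ((k : ℂ) * (((mean d k : ℝ) : ℂ) * u k)) + 2 * α * (((mean d k : ℝ) : ℂ) * u k)
          - ((mean d k : ℝ) : ℂ) * u k ^ 2 := fun k => by
      rw [hm]; push_cast
      linear_combination (-2 * (mean d k : ℂ) * u k * ((k : ℂ) + 1) * α + mean d k * u k ^ 2)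
        * Complex.I_sq
    have this2 : ∀ k : Fin d, (u k : ℂ) * Complex.I * ((1 : ℂ) / 2) ^ ((k : ℕ) + 1)
        = 2 * Complex.I * (((mean d k : ℝ) : ℂ) * u k) := fun k => by rw [hm]; ring
    simp only [sub_self, zero_mul, mul_one, zero_add, sub_zero, add_zero, Finset.sum_const_zero,
      this, this2, ← Finset.mul_sum, ← hα', mul_zero, Finset.sum_sub_distrib,
      Finset.sum_add_distrib]
    push_cast
    rw [hq']
    linear_combination 3 / 2 * (α : ℂ) ^ 2 * Complex.I_sq
  · simp only [defect]; ring

/-! ### The pointwise limit of the characteristic functions -/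

theorem sum_weight_sub_one_mul (z : Fin d → ℂ) (f : ℕ → ℂ) {n : ℕ} (hn : d ≤ n) :
    ∑ j ∈ Finset.range n, (weight z j - 1) * f j = ∑ k : Fin d, (z k - 1) * f k := by
  rw [← Finset.sum_subset (Finset.range_subset_range.2 hn) fun j _ hj => by
    rw [weight_of_le z (not_lt.1 fun h => hj (Finset.mem_range.2 h)), sub_self, zero_mul],
    Finset.sum_range]
  simp only [weight_of_lt]

theorem evalCoeff_succ_eq_two_mul_add (hd : 1 ≤ d) (z : Fin d → ℂ) {n : ℕ} (hn : d ≤ n) :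
    evalCoeff z (n + 1) = 2 * evalCoeff z n
      + ∑ k : Fin d, (z k - 1) * (evalCoeff z (n - k) - evalCoeff z (n - (k + 1))) := by
  have h : ∀ m : ℕ, d ≤ m + 1 → evalCoeff z (m + 1) = ∑ j ∈ Finset.range (m + 1), evalCoeff z j
      + ∑ k : Fin d, (z k - 1) * evalCoeff z (m - k) := fun m hm => by
    have hr := Finset.sum_range_reflect (evalCoeff z) (m + 1)
    rw [Nat.add_sub_cancel] at hr
    rw [evalCoeff_succ, ← sum_weight_sub_one_mul z (fun j => evalCoeff z (m - j)) hm, ← hr,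
      ← Finset.sum_add_distrib]
    exact Finset.sum_congr rfl fun j _ => by ring
  obtain ⟨m, rfl⟩ : ∃ m, n = m + 1 := ⟨n - 1, by omega⟩
  have h1 := h (m + 1) (by omega)
  have h2 := h m hn
  rw [Finset.sum_range_succ] at h1
  simp only [mul_sub, Finset.sum_sub_distrib, Nat.add_sub_add_right]
  linear_combination h1 - h2

/-- With `b n = τⁿ [tⁿ] C(z, t)`, the combination `b n + ∑ (z_k - 1) τ^k (⋯)` of finitely many
consecutive `b`'s, which differs little from `b n` when `z` is close to `1`, changes from `n` to
`n + 1` only by `defect z τ * b n`. -/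
noncomputable def almostInvariant (z : Fin d → ℂ) (τ : ℂ) (n : ℕ) : ℂ :=
  evalCoeff z n * τ ^ n + ∑ k : Fin d, (z k - 1) * τ ^ ((k : ℕ) + 1) *
    (∑ i ∈ Finset.range k, evalCoeff z (n - (i + 1)) * τ ^ (n - (i + 1))
      - τ * ∑ i ∈ Finset.range (k + 1), evalCoeff z (n - (i + 1)) * τ ^ (n - (i + 1)))

theorem almostInvariant_succ (hd : 1 ≤ d) (z : Fin d → ℂ) (τ : ℂ) {n : ℕ} (hn : d ≤ n) :
    almostInvariant z τ (n + 1) = almostInvariant z τ n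
      + defect z τ * (evalCoeff z n * τ ^ n) := by
  set b : ℕ → ℂ := fun n => evalCoeff z n * τ ^ n with hb
  have htel : ∀ k : ℕ, ∑ i ∈ Finset.range k, b (n - i)
      = ∑ i ∈ Finset.range k, b (n - (i + 1)) + (b n - b (n - k)) := fun k => by
    have := Finset.sum_range_sub' (fun i => b (n - i)) k
    rw [Finset.sum_sub_distrib, Nat.sub_zero] at this
    linear_combination this
  have hrec : b (n + 1) = 2 * τ * b n + ∑ k : Fin d, (z k - 1) * τ ^ ((k : ℕ) + 1)
      * (b (n - k) - τ * b (n - (k + 1))) := by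
    simp only [hb]
    rw [evalCoeff_succ_eq_two_mul_add hd z hn, add_mul, Finset.sum_mul]
    congr 1
    · ring
    · refine Finset.sum_congr rfl fun k _ => ?_
      have hk := k.2
      have e1 : τ ^ (n + 1) = τ ^ ((k : ℕ) + 1) * τ ^ (n - k) := by
        rw [← pow_add]; congr 1; omega
      have e2 : τ ^ (n - k) = τ * τ ^ (n - (k + 1)) := by
        rw [← pow_succ']; congr 1; omega
      rw [e1, e2]
      ring
  have hleft : almostInvariant z τ (n + 1) = b (n + 1) + ∑ k : Fin d, (z k - 1) *
      τ ^ ((k : ℕ) + 1) * (∑ i ∈ Finset.range k, b (n - i)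
        - τ * ∑ i ∈ Finset.range (k + 1), b (n - i)) := by
    simp only [almostInvariant, hb, Nat.add_sub_add_right]
  have hright : almostInvariant z τ n = b n + ∑ k : Fin d, (z k - 1) *
      τ ^ ((k : ℕ) + 1) * (∑ i ∈ Finset.range k, b (n - (i + 1))
        - τ * ∑ i ∈ Finset.range (k + 1), b (n - (i + 1))) := rfl
  have hdef : defect z τ = 2 * τ - 1 + ∑ k : Fin d, (z k - 1) * τ ^ ((k : ℕ) + 1) * (1 - τ) := by
    rw [defect, ← Finset.sum_mul]; ring
  rw [hleft, hright, hrec, hdef, add_mul, Finset.sum_mul, add_assoc, ← Finset.sum_add_distrib,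
    show evalCoeff z n * τ ^ n = b n from rfl]
  have : ∀ x y w : ℂ, y = w + x → 2 * τ * b n + y = b n + w + ((2 * τ - 1) * b n + x)
    := fun x y w h => by rw [h]; ring
  refine this _ _ _ ?_
  rw [← Finset.sum_add_distrib]
  refine Finset.sum_congr rfl fun k _ => ?_
  rw [htel, htel]
  ring

theorem norm_sub_le_of_defect (hd : 1 ≤ d) (z : Fin d → ℂ) {τ : ℂ} (hτ : ‖τ‖ ≤ 1) {N : ℕ}
    (hN : d ≤ N) {B : ℝ} (hB : ∀ n ≤ N, ‖evalCoeff z n * τ ^ n‖ ≤ B) :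
    ‖evalCoeff z N * τ ^ N - evalCoeff z d * τ ^ d‖
      ≤ (N * ‖defect z τ‖ + 4 * d * ∑ k, ‖z k - 1‖) * B := by
  have hB0 : 0 ≤ B := (norm_nonneg _).trans (hB 0 (Nat.zero_le _))
  have h1 : ∀ n, d ≤ n → n ≤ N →
      ‖almostInvariant z τ n - almostInvariant z τ d‖ ≤ n * ‖defect z τ‖ * B := by
    intro n hdn
    induction n, hdn using Nat.le_induction with
    | base => intro _; simp; positivity
    | succ n hdn ih =>
      intro hn
      rw [almostInvariant_succ hd z τ hdn, add_sub_right_comm]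
      refine (norm_add_le _ _).trans ?_
      have h2 := ih (by omega)
      have h3 := mul_le_mul_of_nonneg_left (hB n (by omega)) (norm_nonneg (defect z τ))
      rw [norm_mul]
      push_cast
      linarith
  have h2 : ∀ n ≤ N, ‖almostInvariant z τ n - evalCoeff z n * τ ^ n‖
      ≤ 2 * d * (∑ k, ‖z k - 1‖) * B := by
    intro n hn
    have hsum : ∀ k : ℕ, k ≤ d →
        ‖∑ i ∈ Finset.range k, evalCoeff z (n - (i + 1)) * τ ^ (n - (i + 1))‖ ≤ d * B := by
      intro k hk
      refine (norm_sum_le_of_le _ fun i _ => hB (n - (i + 1)) (by omega)).trans ?_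
      rw [Finset.sum_const, Finset.card_range, nsmul_eq_mul]
      gcongr
    rw [almostInvariant, add_sub_cancel_left, Finset.mul_sum, Finset.sum_mul]
    refine norm_sum_le_of_le _ fun k _ => ?_
    rw [norm_mul, norm_mul, norm_pow]
    have e1 : ‖τ‖ ^ ((k : ℕ) + 1) ≤ 1 := pow_le_one₀ (norm_nonneg _) hτ
    have e2 := hsum k k.2.le
    have e3 := hsum (k + 1) k.2
    have e4 : ‖τ * ∑ i ∈ Finset.range (k + 1),
        evalCoeff z (n - (i + 1)) * τ ^ (n - (i + 1))‖ ≤ d * B := by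
      rw [norm_mul]; exact (mul_le_of_le_one_left (norm_nonneg _) hτ).trans e3
    calc _ ≤ ‖z k - 1‖ * 1 * (d * B + d * B) := by
          gcongr
          exact (norm_sub_le _ _).trans (add_le_add e2 e4)
      _ = _ := by ring
  have e1 := h1 N hN le_rfl
  have e2 := h2 N le_rfl
  have e3 := h2 d hN
  calc _ = ‖(almostInvariant z τ N - almostInvariant z τ d)
          - (almostInvariant z τ N - evalCoeff z N * τ ^ N)
          + (almostInvariant z τ d - evalCoeff z d * τ ^ d)‖ := by congr 1; ring
    _ ≤ _ := (norm_add_le _ _).trans (by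
        have := norm_sub_le (almostInvariant z τ N - almostInvariant z τ d)
          (almostInvariant z τ N - evalCoeff z N * τ ^ N)
        linarith)

theorem evalCoeff_one_succ (n : ℕ) : evalCoeff (fun _ : Fin d => (1 : ℂ)) (n + 1) = 2 ^ n := by
  have hw : ∀ j, weight (fun _ : Fin d => (1 : ℂ)) j = 1 := fun j => by simp [weight]
  have hs : ∀ m, ∑ j ∈ Finset.range (m + 1), evalCoeff (fun _ : Fin d => (1 : ℂ)) j = 2 ^ m := by
    intro m
    induction m with
    | zero => simp [evalCoeff_zero]
    | succ m ih =>
      rw [Finset.sum_range_succ, evalCoeff_succ']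
      simp only [hw, mul_one, ih]
      ring
  rw [evalCoeff_succ']
  simp only [hw, mul_one, hs]

theorem continuous_evalCoeff (n : ℕ) : Continuous fun z : Fin d → ℂ => evalCoeff z n := by
  unfold evalCoeff
  simp only [MvPolynomial.aeval_def, MvPolynomial.eval₂_eq]
  fun_prop

theorem continuous_torusPoint : Continuous (torusPoint : (Fin d → ℝ) → Fin d → ℂ) := by
  unfold torusPoint
  fun_prop

theorem torusPoint_zero : torusPoint (0 : Fin d → ℝ) = fun _ => 1 := by
  ext; simp [torusPoint]

/-- The characteristic function of the standardized occurrence vector of a random composition of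
`n` converges to that of a Gaussian vector. The limit is `1/2` times the latter, as `n` has
`2 ^ (n - 1)` compositions. -/
theorem tendsto_evalCoeff (hd : 1 ≤ d) (u : Fin d → ℝ) :
    Tendsto (fun n : ℕ => evalCoeff (torusPoint ((√(n : ℝ))⁻¹ • u)) n / 2 ^ n
        * Complex.exp (-((√(n : ℝ) * (mean d ⬝ᵥ u) : ℝ) : ℂ) * Complex.I)) atTop
      (𝓝 (1 / 2 * Complex.exp (-(hessForm u / 2 : ℝ)))) := by
  set q := hessForm u with hq
  set α := mean d ⬝ᵥ u with hα
  let x : ℕ → ℝ := fun n => (√(n : ℝ))⁻¹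
  have hx : Tendsto x atTop (𝓝 0) :=
    (Real.tendsto_sqrt_atTop.comp tendsto_natCast_atTop_atTop).inv_tendsto_atTop
  have hτc : Continuous (approxRoot u) := by unfold approxRoot; fun_prop
  have hτ0 : approxRoot u 0 = 1 / 2 := by simp [approxRoot]
  have hτ : Tendsto (fun n => approxRoot u (x n)) atTop (𝓝 (1 / 2)) := by
    rw [← hτ0]; exact (hτc.tendsto 0).comp hx
  have hz : Tendsto (fun n => torusPoint (x n • u)) atTop (𝓝 fun _ => 1) := by
    have : Continuous fun y : ℝ => torusPoint (y • u) :=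
      continuous_torusPoint.comp (by fun_prop)
    have h := (this.tendsto 0).comp hx
    rw [zero_smul, torusPoint_zero] at h
    exact h
  -- The power `τⁿ` of the approximate root is the normalization wanted, up to a constant.
  have hpow : ∀ n : ℕ, ∀ m : ℕ, approxRoot u (x n) ^ m = (1 / 2) ^ m
      * Complex.exp (m * (-(α : ℂ) * Complex.I * x n + (q / 2 : ℝ) * (x n : ℂ) ^ 2)) := by
    intro n m
    rw [approxRoot, mul_pow, Complex.exp_nat_mul]
  have hB : ∀ n : ℕ, 0 < n → ∀ m ≤ n,
      ‖evalCoeff (torusPoint (x n • u)) m * approxRoot u (x n) ^ m‖ ≤ Real.exp (|q|) := by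
    intro n hn m hm
    rw [hpow, norm_mul, norm_mul, norm_pow, Complex.norm_exp]
    have h1 := norm_evalCoeff_le (norm_torusPoint_le (x n • u)) m
    have hre : ((m : ℂ) * (-(α : ℂ) * Complex.I * x n + (q / 2 : ℝ) * (x n : ℂ) ^ 2)).re
        = m * (q / 2 * x n ^ 2) := by
      rw [← Complex.ofReal_pow, ← Complex.ofReal_natCast, Complex.re_ofReal_mul]
      simp [-Complex.ofReal_pow]
    have hx2 : x n ^ 2 = (n : ℝ)⁻¹ := by
      simp only [x]; rw [inv_pow, Real.sq_sqrt (Nat.cast_nonneg _)]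
    have h2 : (m : ℝ) * (q / 2 * x n ^ 2) ≤ |q| := by
      have hn' : (0 : ℝ) < n := by exact_mod_cast hn
      have hmn : (m : ℝ) / n ≤ 1 := (div_le_one hn').2 (by exact_mod_cast hm)
      have hmn0 : (0 : ℝ) ≤ (m : ℝ) / n := by positivity
      rw [hx2, show (m : ℝ) * (q / 2 * (n : ℝ)⁻¹) = (m : ℝ) / n * (q / 2) by ring]
      have := le_abs_self q
      have := abs_nonneg q
      nlinarith
    rw [hre]
    calc _ ≤ 2 ^ m * (‖(1 / 2 : ℂ)‖ ^ m * Real.exp |q|) := by gcongr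
      _ = Real.exp |q| := by
        rw [← mul_assoc, ← mul_pow]; norm_num
  have hdefect : Tendsto (fun n : ℕ => (n : ℝ) * ‖defect (torusPoint (x n • u))
      (approxRoot u (x n))‖) atTop (𝓝 0) := by
    have h1 := ((isLittleO_defect u).comp_tendsto hx).norm_left.tendsto_div_nhds_zero
    refine h1.congr fun n => ?_
    simp only [Function.comp, x]
    rw [inv_pow, Real.sq_sqrt (Nat.cast_nonneg _), div_inv_eq_mul, mul_comm]
  have hε : Tendsto (fun n : ℕ => ∑ k, ‖torusPoint (x n • u) k - 1‖) atTop (𝓝 0) := by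
    rw [show (0 : ℝ) = ∑ k : Fin d, ‖(1 : ℂ) - 1‖ by simp]
    refine tendsto_finsetSum _ fun k _ => ?_
    exact (((tendsto_pi_nhds.1 hz k).sub_const 1)).norm
  have hstart : Tendsto (fun n => evalCoeff (torusPoint (x n • u)) d * approxRoot u (x n) ^ d)
      atTop (𝓝 (1 / 2)) := by
    have h := (((continuous_evalCoeff d).tendsto _).comp hz).mul (hτ.pow d)
    obtain ⟨e, rfl⟩ : ∃ e, d = e + 1 := ⟨d - 1, by omega⟩
    rw [evalCoeff_one_succ, show (2 : ℂ) ^ e * (1 / 2) ^ (e + 1) = 1 / 2 by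
      rw [pow_succ, ← mul_assoc, ← mul_pow]; norm_num] at h
    exact h
  have hdiff : Tendsto (fun n : ℕ => evalCoeff (torusPoint (x n • u)) n * approxRoot u (x n) ^ n
      - evalCoeff (torusPoint (x n • u)) d * approxRoot u (x n) ^ d) atTop (𝓝 0) := by
    have hbound := (hdefect.add (hε.const_mul (4 * d : ℝ))).mul_const (Real.exp |q|)
    rw [mul_zero, add_zero, zero_mul] at hbound
    refine squeeze_zero_norm' ?_ hbound
    have hnorm : ∀ᶠ n in atTop, ‖approxRoot u (x n)‖ < 1 :=
      hτ.norm.eventually_lt_const (by norm_num)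
    filter_upwards [hnorm, eventually_ge_atTop d] with n h1 h2
    exact norm_sub_le_of_defect hd _ h1.le h2 (hB n (by omega))
  have hmain := (hdiff.add hstart).mul_const (Complex.exp (-(q / 2 : ℝ)))
  rw [zero_add] at hmain
  refine hmain.congr' ?_
  filter_upwards [eventually_gt_atTop 0] with n hn
  have hn' : (0 : ℝ) < n := by exact_mod_cast hn
  have hs : (√(n : ℝ)) ^ 2 = n := Real.sq_sqrt hn'.le
  have hs0 : √(n : ℝ) ≠ 0 := (Real.sqrt_pos.2 hn').ne'
  have e1 : (n : ℝ) * x n = √(n : ℝ) := by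
    simp only [x]; rw [mul_inv_eq_iff_eq_mul₀ hs0]; linarith
  have e2 : (n : ℝ) * x n ^ 2 = 1 := by
    simp only [x]; rw [inv_pow, hs]; field_simp
  have e1' : (n : ℂ) * x n = (√(n : ℝ) : ℝ) := by rw [← e1]; push_cast; rfl
  have e2' : (n : ℂ) * (x n : ℂ) ^ 2 = 1 := by exact_mod_cast congrArg Complex.ofReal e2
  rw [sub_add_cancel, hpow, mul_assoc, mul_assoc, ← Complex.exp_add, div_mul_eq_mul_div,
    mul_div_assoc]
  congr 1
  rw [one_div, inv_pow, ← div_eq_inv_mul]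
  congr 2
  push_cast
  linear_combination (-(α : ℂ) * Complex.I) * e1' + (q / 2 : ℂ) * e2'

/-! ### Characteristic functions and their domination -/

theorem norm_evalCoeff_rescaled_le (hd : 1 ≤ d) {n : ℕ} (hn : 0 < n) {u : Fin d → ℝ}
    (hu : ∀ k, |((√(n : ℝ))⁻¹ • u) k| ≤ Real.pi) :
    ‖evalCoeff (torusPoint ((√(n : ℝ))⁻¹ • u)) n / 2 ^ n‖
      ≤ 2 ^ d * Real.exp (-decayRate d * ∑ k, u k ^ 2) := by
  have h := norm_evalCoeff_torusPoint_le hd hu n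
  have hn' : (0 : ℝ) < n := by exact_mod_cast hn
  have hs : (n : ℝ) * ∑ k, ((√(n : ℝ))⁻¹ • u) k ^ 2 = ∑ k, u k ^ 2 := by
    simp only [Pi.smul_apply, smul_eq_mul, mul_pow, inv_pow, Real.sq_sqrt hn'.le]
    rw [← Finset.mul_sum, mul_inv_cancel_left₀ hn'.ne']
  rw [hs] at h
  rw [norm_div, norm_pow, Complex.norm_ofNat, div_le_iff₀' (by positivity)]
  exact h

/-- The fundamental domain `(-π, π]^d` of the torus. -/
def torusBox (d : ℕ) : Set (Fin d → ℝ) := Set.univ.pi fun _ => Set.Ioc (-Real.pi) Real.pi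

theorem measurableSet_torusBox : MeasurableSet (torusBox d) :=
  MeasurableSet.univ_pi fun _ => measurableSet_Ioc

/-- The characteristic function of the centered occurrence vector of a random composition of `n`,
divided by `√n`. It is cut off outside a fundamental domain, and halved, because the division is
by `2 ^ n` while there are `2 ^ (n - 1)` compositions. -/
noncomputable def charFunction (d n : ℕ) (u : Fin d → ℝ) : ℂ :=
  (torusBox d).indicator (fun θ => evalCoeff (torusPoint θ) n) ((√(n : ℝ))⁻¹ • u) / 2 ^ n
    * Complex.exp (-((√(n : ℝ) * (mean d ⬝ᵥ u) : ℝ) : ℂ) * Complex.I)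

theorem measurable_charFunction (n : ℕ) : Measurable (charFunction d n) := by
  have h1 : Measurable fun θ : Fin d → ℝ => evalCoeff (torusPoint θ) n :=
    ((continuous_evalCoeff n).comp continuous_torusPoint).measurable
  have h2 : Measurable fun u : Fin d → ℝ => (√(n : ℝ))⁻¹ • u :=
    (continuous_const_smul _).measurable
  have h3 : Measurable fun u : Fin d → ℝ =>
      Complex.exp (-((√(n : ℝ) * (mean d ⬝ᵥ u) : ℝ) : ℂ) * Complex.I) := by
    unfold dotProduct
    exact Continuous.measurable (by fun_prop)
  exact (((h1.indicator measurableSet_torusBox).comp h2).div_const _).mul h3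

theorem norm_charFunction_le (hd : 1 ≤ d) {n : ℕ} (hn : 0 < n) (u : Fin d → ℝ) :
    ‖charFunction d n u‖ ≤ 2 ^ d * Real.exp (-decayRate d * ∑ k, u k ^ 2) := by
  have hre : -((√(n : ℝ) * (mean d ⬝ᵥ u) : ℝ) : ℂ) * Complex.I
      = ((-(√(n : ℝ) * (mean d ⬝ᵥ u)) : ℝ) : ℂ) * Complex.I := by push_cast; rfl
  rw [charFunction, norm_mul, hre, Complex.norm_exp_ofReal_mul_I, mul_one]
  by_cases hu : (√(n : ℝ))⁻¹ • u ∈ torusBox d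
  · rw [Set.indicator_of_mem hu]
    refine norm_evalCoeff_rescaled_le hd hn fun k => abs_le.2 ?_
    have := hu k (Set.mem_univ k)
    exact ⟨this.1.le, this.2⟩
  · rw [Set.indicator_of_notMem hu, zero_div, norm_zero]
    positivity

theorem tendsto_charFunction (hd : 1 ≤ d) (u : Fin d → ℝ) :
    Tendsto (fun n => charFunction d n u) atTop
      (𝓝 (1 / 2 * Complex.exp (-(hessForm u / 2 : ℝ)))) := by
  refine (tendsto_evalCoeff hd u).congr' ?_
  have hsmall : ∀ k, ∀ᶠ n : ℕ in atTop, ((√(n : ℝ))⁻¹ • u) k ∈ Set.Ioc (-Real.pi) Real.pi :=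
    fun k => by
    have h0 : Tendsto (fun n : ℕ => ((√(n : ℝ))⁻¹ • u) k) atTop (𝓝 0) := by
      have := (Real.tendsto_sqrt_atTop.comp
        tendsto_natCast_atTop_atTop).inv_tendsto_atTop.mul_const (u k)
      simpa using this
    exact h0.eventually_mem (Ioc_mem_nhds (by linarith [Real.pi_pos]) Real.pi_pos)
  filter_upwards [eventually_all.2 hsmall] with n hn
  have : (√(n : ℝ))⁻¹ • u ∈ torusBox d := fun k _ => hn k
  rw [charFunction, Set.indicator_of_mem this]

theorem measurable_exp_neg_hessForm :
    Measurable fun u : Fin d → ℝ => (1 / 2 : ℂ) * Complex.exp (-(hessForm u / 2 : ℝ)) := by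
  unfold hessForm dotProduct Matrix.mulVec dotProduct
  exact Continuous.measurable (by fun_prop)

/-- The uniform decay of the characteristic functions passes to their limit. -/
theorem norm_exp_neg_hessForm_le (hd : 1 ≤ d) (u : Fin d → ℝ) :
    ‖(1 / 2 : ℂ) * Complex.exp (-(hessForm u / 2 : ℝ))‖
      ≤ 2 ^ d * Real.exp (-decayRate d * ∑ k, u k ^ 2) :=
  le_of_tendsto (tendsto_charFunction hd u).norm
    ((eventually_gt_atTop 0).mono fun _ hn => norm_charFunction_le hd hn u)

/-! ### Positivity and determinant of the Hessian, and Gaussian integrals -/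

theorem hessForm_smul (r : ℝ) (u : Fin d → ℝ) : hessForm (r • u) = r ^ 2 * hessForm u := by
  simp only [hessForm, Matrix.mulVec_smul, smul_dotProduct, dotProduct_smul, smul_eq_mul]
  ring

theorem le_hessForm (hd : 1 ≤ d) (u : Fin d → ℝ) :
    2 * decayRate d * ∑ k, u k ^ 2 ≤ hessForm u := by
  by_contra! hlt
  set t := decayRate d * ∑ k, u k ^ 2 - hessForm u / 2 with ht
  have ht0 : 0 < t := by rw [ht]; linarith
  -- Along the ray through `u` the two Gaussians would decay at the wrong relative rate.
  have hr : ∀ r : ℝ, Real.exp (r ^ 2 * t) ≤ 2 * 2 ^ d := fun r => by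
    have h := norm_exp_neg_hessForm_le hd (r • u)
    rw [norm_mul, ← Complex.ofReal_neg, Complex.norm_exp_ofReal, hessForm_smul] at h
    norm_num only [norm_div, norm_one, Complex.norm_ofNat] at h
    have hs : ∑ k, (r • u) k ^ 2 = r ^ 2 * ∑ k, u k ^ 2 := by
      simp only [Pi.smul_apply, smul_eq_mul, mul_pow, Finset.mul_sum]
    rw [hs] at h
    have e : Real.exp (r ^ 2 * t) = Real.exp (-(r ^ 2 * hessForm u / 2))
        / Real.exp (-decayRate d * (r ^ 2 * ∑ k, u k ^ 2)) := by
      rw [← Real.exp_sub, ht]; congr 1; ring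
    rw [e, div_le_iff₀ (Real.exp_pos _)]
    linarith
  have h1 := hr √(2 * 2 ^ d / t)
  rw [Real.sq_sqrt (by positivity), div_mul_cancel₀ _ ht0.ne'] at h1
  linarith [Real.add_one_le_exp (2 * 2 ^ d : ℝ)]

theorem posDef_hess (hd : 1 ≤ d) : (hess d).PosDef := by
  refine Matrix.PosDef.of_dotProduct_mulVec_pos ?_ fun u hu => ?_
  · ext i j
    simp only [Matrix.conjTranspose_apply, star_trivial, hess_apply]
    by_cases h : i = j
    · subst h; rfl
    · rw [if_neg h, if_neg (Ne.symm h)]; ring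
  · have h := le_hessForm hd u
    have hpos : 0 < ∑ k, u k ^ 2 := by
      obtain ⟨k, hk⟩ := Function.ne_iff.1 hu
      exact Finset.sum_pos' (fun _ _ => sq_nonneg _) ⟨k, Finset.mem_univ _, by
        have : u k ≠ 0 := hk
        positivity⟩
    have := decayRate_pos hd
    rw [star_trivial]
    exact lt_of_lt_of_le (by positivity) h

theorem sum_mean (d : ℕ) : ∑ k, mean d k = (1 - (2 ^ d)⁻¹) / 2 := by
  simp only [mean]
  rw [Fin.sum_univ_eq_sum_range fun k => 1 / (2 : ℝ) ^ (k + 1 + 1)]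
  induction d with
  | zero => simp
  | succ d ih => rw [Finset.sum_range_succ, ih]; simp only [pow_succ]; field_simp; ring

theorem sum_mul_mean (d : ℕ) :
    ∑ k : Fin d, (k : ℝ) * mean d k = (1 - (d + 1) * (2 ^ d)⁻¹) / 2 := by
  simp only [mean]
  rw [Fin.sum_univ_eq_sum_range fun k => (k : ℝ) * (1 / (2 : ℝ) ^ (k + 1 + 1))]
  induction d with
  | zero => simp
  | succ d ih =>
    rw [Finset.sum_range_succ, ih]; simp only [pow_succ]; push_cast; field_simp; ring

theorem sum_sq_mul_mean (d : ℕ) :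
    ∑ k : Fin d, (k : ℝ) ^ 2 * mean d k = (3 - ((d : ℝ) ^ 2 + 2 * d + 3) * (2 ^ d)⁻¹) / 2 := by
  simp only [mean]
  rw [Fin.sum_univ_eq_sum_range fun k => (k : ℝ) ^ 2 * (1 / (2 : ℝ) ^ (k + 1 + 1))]
  induction d with
  | zero => simp
  | succ d ih =>
    rw [Finset.sum_range_succ, ih]; simp only [pow_succ]; push_cast; field_simp; ring

/-- The Hessian is a diagonal matrix times a perturbation of the identity of rank two. -/
theorem det_hess_eq_prod_mean (d : ℕ) :
    (hess d).det = (∏ k, mean d k)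
      * ((2 ^ d)⁻¹ ^ 2 / 4 * (((d : ℝ) ^ 2 + 4 * d + 6) * 2 ^ d - 2)) := by
  let P : Matrix (Fin d) (Fin 2) ℝ := Matrix.of fun i => ![1 - (i : ℝ), -1]
  let Q : Matrix (Fin 2) (Fin d) ℝ := Matrix.of ![fun j => mean d j, fun j => (j : ℝ) * mean d j]
  have hfac : hess d = Matrix.diagonal (mean d) * (1 + P * Q) := by
    ext i j
    rw [Matrix.diagonal_mul, Matrix.add_apply, Matrix.mul_apply, Fin.sum_univ_two, hess_apply,
      Matrix.one_apply]
    simp only [P, Q, Matrix.of_apply, Matrix.cons_val_zero, Matrix.cons_val_one]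
    split_ifs <;> ring
  have e00 : (Q * P) 0 0 = ∑ k, mean d k - ∑ k : Fin d, (k : ℝ) * mean d k := by
    rw [Matrix.mul_apply, ← Finset.sum_sub_distrib]
    refine Finset.sum_congr rfl fun k _ => ?_
    simp only [P, Q, Matrix.of_apply, Matrix.cons_val_zero]
    ring
  have e01 : (Q * P) 0 1 = -∑ k, mean d k := by
    rw [Matrix.mul_apply, ← Finset.sum_neg_distrib]
    refine Finset.sum_congr rfl fun k _ => ?_
    simp [P, Q]
  have e10 : (Q * P) 1 0 = ∑ k : Fin d, (k : ℝ) * mean d k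
      - ∑ k : Fin d, (k : ℝ) ^ 2 * mean d k := by
    rw [Matrix.mul_apply, ← Finset.sum_sub_distrib]
    refine Finset.sum_congr rfl fun k _ => ?_
    simp only [P, Q, Matrix.of_apply, Matrix.cons_val_zero, Matrix.cons_val_one]
    ring
  have e11 : (Q * P) 1 1 = -∑ k : Fin d, (k : ℝ) * mean d k := by
    rw [Matrix.mul_apply, ← Finset.sum_neg_distrib]
    refine Finset.sum_congr rfl fun k _ => ?_
    simp [P, Q]
  have h2 : (2 : ℝ) ^ d ≠ 0 := by positivity
  rw [hfac, Matrix.det_mul, Matrix.det_diagonal, Matrix.det_one_add_mul_comm, Matrix.det_fin_two]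
  simp only [Matrix.add_apply, e00, e01, e10, e11, Matrix.one_apply_eq, ne_eq, zero_ne_one,
    one_ne_zero, not_false_eq_true, Matrix.one_apply_ne, sum_mean, sum_mul_mean, sum_sq_mul_mean]
  congr 1
  field_simp
  ring

theorem prod_mean (d : ℕ) :
    ∏ k, mean d k = (2 : ℝ) ^ (-((d : ℝ) ^ 2 / 2 + 3 * d / 2)) := by
  have h : ∀ k : Fin d, mean d k = (2 : ℝ) ^ (-((k : ℝ) + 2)) := fun k => by
    rw [mean, Real.rpow_neg (by norm_num), one_div, ← Real.rpow_natCast]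
    push_cast
    congr 2
    ring
  simp only [h]
  rw [← Real.rpow_sum_of_pos (by norm_num), Fin.sum_univ_eq_sum_range fun k => -((k : ℝ) + 2)]
  congr 1
  clear h
  induction d with
  | zero => simp
  | succ d ih => rw [Finset.sum_range_succ, ih]; push_cast; ring

theorem A_eq (d n : ℕ) : A d n = 2 ^ n * (n : ℝ) ^ (-((d : ℝ) / 2))
    * (1 / (2 * (2 * Real.pi) ^ ((d : ℝ) / 2) * √(hess d).det)) := by
  set D := ((d : ℝ) ^ 2 + 4 * d + 6) * 2 ^ d - 2 with hD
  set p := (2 : ℝ) ^ ((d : ℝ) ^ 2 / 4 + 7 * d / 4 + 1) with hp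
  have hp0 : 0 < p := by positivity
  have hdet : (hess d).det = D / p ^ 2 := by
    have h1 : (∏ k, mean d k) * (2 ^ d)⁻¹ ^ 2 / 4 = (p ^ 2)⁻¹ := by
      have e4 : (4 : ℝ)⁻¹ = 2 ^ (-2 : ℝ) := by
        rw [Real.rpow_neg (by norm_num)]; norm_num
      have ed : ((2 : ℝ) ^ d)⁻¹ ^ 2 = 2 ^ (-(2 * d : ℝ)) := by
        rw [Real.rpow_neg (by norm_num), inv_pow, ← pow_mul, ← Real.rpow_natCast]
        push_cast
        rw [mul_comm]
      have ep : p ^ 2 = 2 ^ (((d : ℝ) ^ 2 / 4 + 7 * d / 4 + 1) * 2) := by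
        rw [hp, Real.rpow_mul (by norm_num), Real.rpow_two]
      rw [prod_mean, div_eq_mul_inv, e4, ed, ← Real.rpow_add (by norm_num),
        ← Real.rpow_add (by norm_num), ep, ← Real.rpow_neg (by norm_num)]
      congr 1
      ring
    rw [det_hess_eq_prod_mean, div_eq_mul_inv D, ← h1]
    ring
  rw [A, hdet, Real.sqrt_div' _ (by positivity), Real.sqrt_sq hp0.le]
  congr 1
  rw [← mul_div_assoc, one_div_div]

/-- The Fourier transform of a centered Gaussian with inverse covariance matrix `S`. -/
theorem integral_cexp_neg_quadratic {ι : Type*} [Fintype ι] [DecidableEq ι] {S : Matrix ι ι ℝ}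
    (hS : S.PosDef) (v : ι → ℝ) :
    ∫ u : ι → ℝ, Complex.exp (-((u ⬝ᵥ S *ᵥ u) / 2 : ℝ) + Complex.I * (v ⬝ᵥ u : ℝ))
      = (((2 * Real.pi) ^ ((Fintype.card ι : ℝ) / 2) / √S.det
          * Real.exp (-((v ᵥ* S⁻¹) ⬝ᵥ v) / 2) : ℝ) : ℂ) := by
  obtain ⟨B, hB⟩ : ∃ B : Matrix ι ι ℝ, S = Bᵀ * B := by
    open scoped MatrixOrder in
    obtain ⟨B, hB⟩ := CStarAlgebra.nonneg_iff_eq_star_mul_self.mp hS.posSemidef.nonneg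
    exact ⟨B, by rw [hB, Matrix.star_eq_conjTranspose, Matrix.conjTranspose_eq_transpose_of_trivial]⟩
  have hdet : S.det = B.det ^ 2 := by rw [hB, Matrix.det_mul, Matrix.det_transpose, sq]
  have hB0 : B.det ≠ 0 := fun h => hS.det_pos.ne' (by rw [hdet, h]; norm_num)
  have hBu : IsUnit B.det := hB0.isUnit
  have hsqrt : √S.det = |B.det| := by rw [hdet, Real.sqrt_sq_eq_abs]
  set c : ι → ℝ := v ᵥ* B⁻¹ with hc
  let G : (ι → ℝ) → ℂ := fun w =>
    Complex.exp (-(1 / 2 : ℂ) * ∑ i, (w i : ℂ) ^ 2 + ∑ i, (Complex.I * c i) * w i)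
  have hG : Continuous G := by fun_prop
  have hcomp : ∀ u : ι → ℝ, Complex.exp (-((u ⬝ᵥ S *ᵥ u) / 2 : ℝ) + Complex.I * (v ⬝ᵥ u : ℝ))
      = G (Matrix.toLin' B u) := by
    intro u
    have h1 : u ⬝ᵥ S *ᵥ u = ∑ i, (B *ᵥ u) i ^ 2 := by
      rw [hB, ← Matrix.mulVec_mulVec, Matrix.dotProduct_mulVec, Matrix.vecMul_transpose]
      simp only [dotProduct, sq]
    have h2 : v ⬝ᵥ u = ∑ i, c i * (B *ᵥ u) i := by
      change _ = c ⬝ᵥ B *ᵥ u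
      rw [hc, ← Matrix.dotProduct_mulVec, Matrix.mulVec_mulVec, Matrix.nonsing_inv_mul _ hBu,
        Matrix.one_mulVec]
    simp only [G, Matrix.toLin'_apply]
    rw [h1, h2]
    congr 1
    push_cast
    rw [Finset.mul_sum]
    congr 1
    · ring
    · exact Finset.sum_congr rfl fun i _ => by ring
  have hcc : c ⬝ᵥ c = (v ᵥ* S⁻¹) ⬝ᵥ v := by
    rw [hB, Matrix.mul_inv_rev, ← Matrix.vecMul_vecMul, ← hc, ← Matrix.transpose_nonsing_inv,
      Matrix.vecMul_transpose, dotProduct_comm, dotProduct_comm (B⁻¹ *ᵥ c), Matrix.dotProduct_mulVec]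
  have hcv : ∫ u, G (Matrix.toLin' B u) = (|B.det|⁻¹ : ℝ) • ∫ w, G w := by
    have hmeas : Measurable (Matrix.toLin' B) :=
      (LinearMap.continuous_of_finiteDimensional _).measurable
    rw [← MeasureTheory.integral_map hmeas.aemeasurable hG.aestronglyMeasurable,
      Real.map_matrix_volume_pi_eq_smul_volume_pi hB0, MeasureTheory.integral_smul_measure,
      ENNReal.toReal_ofReal (abs_nonneg _), abs_inv]
  have hint : ∫ w, G w = (((2 * Real.pi) ^ ((Fintype.card ι : ℝ) / 2)
      * Real.exp (-((v ᵥ* S⁻¹) ⬝ᵥ v) / 2) : ℝ) : ℂ) := by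
    have h := GaussianFourier.integral_cexp_neg_mul_sum_add (b := 1 / 2) (by norm_num)
      fun i => Complex.I * (c i : ℂ)
    refine h.trans ?_
    rw [Complex.ofReal_mul, Complex.ofReal_cpow (by positivity), Complex.ofReal_exp]
    congr 1
    · push_cast
      congr 1
      ring
    · congr 1
      rw [← hcc, dotProduct]
      simp only [mul_pow, Complex.I_sq, ← Finset.mul_sum]
      push_cast
      simp only [← sq]
      ring
  simp only [hcomp]
  rw [hcv, hint, hsqrt, Complex.real_smul, ← Complex.ofReal_mul]
  congr 1
  ring

/-! ### Fourier inversion and the local limit theorem -/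

theorem integral_exp_int_mul (m : ℤ) :
    ∫ t in Set.Ioc (-Real.pi) Real.pi, Complex.exp (m * (t * Complex.I))
      = if m = 0 then (2 * Real.pi : ℂ) else 0 := by
  rw [← intervalIntegral.integral_of_le (by linarith [Real.pi_pos])]
  split_ifs with h
  · subst h
    simp
    ring
  · have hm : (m : ℂ) * Complex.I ≠ 0 := mul_ne_zero (by exact_mod_cast h) Complex.I_ne_zero
    have e : ∀ t : ℝ, Complex.exp (m * (t * Complex.I)) = Complex.exp (m * Complex.I * t) :=
      fun t => by congr 1; ring
    simp only [e]
    rw [integral_exp_mul_complex hm]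
    have e2 : (m : ℂ) * Complex.I * (Real.pi : ℝ)
        = (m : ℂ) * Complex.I * ((-Real.pi : ℝ) : ℂ) + m * (2 * Real.pi * Complex.I) := by
      push_cast; ring
    rw [e2, Complex.exp_add, Complex.exp_int_mul_two_pi_mul_I, mul_one, sub_self, zero_div]

theorem integrableOn_torusBox {f : (Fin d → ℝ) → ℂ} (hf : Continuous f) :
    MeasureTheory.IntegrableOn f (torusBox d) :=
  (hf.continuousOn.integrableOn_compact
    (isCompact_univ_pi fun _ : Fin d => isCompact_Icc (a := -Real.pi) (b := Real.pi))).mono_set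
    (Set.pi_mono fun _ _ => Set.Ioc_subset_Icc_self)

/-- Fourier inversion: the coefficients of a polynomial are its Fourier coefficients on the
torus. -/
theorem integral_torusBox_aeval (p : MvPolynomial (Fin d) ℝ) (s : Fin d →₀ ℕ) :
    ∫ θ in torusBox d, MvPolynomial.aeval (torusPoint θ) p
        * Complex.exp (-(∑ k, (s k : ℝ) * θ k : ℝ) * Complex.I)
      = (2 * Real.pi) ^ d * (MvPolynomial.coeff s p : ℝ) := by
  have hterm : ∀ (m : Fin d →₀ ℕ), ∀ θ : Fin d → ℝ,
      (∏ k, torusPoint θ k ^ m k) * Complex.exp (-(∑ k, (s k : ℝ) * θ k : ℝ) * Complex.I)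
        = ∏ k, Complex.exp (((m k : ℤ) - s k : ℤ) * (θ k * Complex.I)) := by
    intro m θ
    simp only [torusPoint, ← Complex.exp_nat_mul]
    rw [← Complex.exp_sum, ← Complex.exp_add, ← Complex.exp_sum]
    congr 1
    push_cast
    rw [neg_mul, Finset.sum_mul, ← sub_eq_add_neg, ← Finset.sum_sub_distrib]
    exact Finset.sum_congr rfl fun k _ => by ring
  have hint : ∀ m : Fin d →₀ ℕ, ∫ θ in torusBox d,
      ∏ k, Complex.exp (((m k : ℤ) - s k : ℤ) * (θ k * Complex.I))
        = if m = s then (2 * Real.pi : ℂ) ^ d else 0 := by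
    intro m
    rw [torusBox, MeasureTheory.volume_pi, MeasureTheory.Measure.restrict_pi_pi,
      MeasureTheory.integral_fintype_prod_eq_prod
        (fun k t => Complex.exp (((m k : ℤ) - s k : ℤ) * ((t : ℝ) * Complex.I)))]
    simp only [integral_exp_int_mul]
    split_ifs with h
    · subst h; simp
    · obtain ⟨k, hk⟩ := Finsupp.ne_iff.1 h
      refine Finset.prod_eq_zero (Finset.mem_univ k) (if_neg ?_)
      exact sub_ne_zero.2 (by exact_mod_cast hk)
  have hexp : ∀ θ : Fin d → ℝ, MvPolynomial.aeval (torusPoint θ) p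
        * Complex.exp (-(∑ k, (s k : ℝ) * θ k : ℝ) * Complex.I)
      = ∑ m ∈ p.support, ((MvPolynomial.coeff m p : ℝ) : ℂ)
        * ∏ k, Complex.exp (((m k : ℤ) - s k : ℤ) * (θ k * Complex.I)) := by
    intro θ
    rw [MvPolynomial.aeval_def, MvPolynomial.eval₂_eq', Finset.sum_mul]
    refine Finset.sum_congr rfl fun m _ => ?_
    rw [mul_assoc, hterm]
    rfl
  simp only [hexp]
  rw [MeasureTheory.integral_finsetSum _ fun m _ =>
    integrableOn_torusBox (by fun_prop)]
  simp only [MeasureTheory.integral_const_mul, hint, mul_ite, mul_zero]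
  rw [Finset.sum_ite_eq']
  split_ifs with h
  · ring
  · rw [MvPolynomial.notMem_support_iff.1 h]; simp

theorem integrable_exp_neg_mul_sum_sq {c : ℝ} (hc : 0 < c) :
    MeasureTheory.Integrable fun u : Fin d → ℝ => Real.exp (-c * ∑ k, u k ^ 2) := by
  have h := (GaussianFourier.integrable_cexp_neg_mul_sum_add (ι := Fin d) (b := (c : ℂ))
    (by simpa using hc) 0).norm
  refine h.congr (Eventually.of_forall fun u => ?_)
  simp only [Pi.zero_apply, zero_mul, Finset.sum_const_zero, add_zero]
  rw [← Complex.norm_exp_ofReal]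
  push_cast
  rfl

theorem tendsto_integral_norm_charFunction_sub (hd : 1 ≤ d) :
    Tendsto (fun n : ℕ => ∫ u : Fin d → ℝ,
      ‖charFunction d n u - 1 / 2 * Complex.exp (-(hessForm u / 2 : ℝ))‖) atTop (𝓝 0) := by
  rw [show (0 : ℝ) = ∫ _ : Fin d → ℝ, (0 : ℝ) by simp]
  refine MeasureTheory.tendsto_integral_filter_of_dominated_convergence
    (fun u => 2 * (2 ^ d * Real.exp (-decayRate d * ∑ k, u k ^ 2))) ?_ ?_ ?_ ?_
  · exact Eventually.of_forall fun n =>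
      ((measurable_charFunction n).sub measurable_exp_neg_hessForm).norm.aestronglyMeasurable
  · filter_upwards [eventually_gt_atTop 0] with n hn
    refine Eventually.of_forall fun u => ?_
    rw [norm_norm]
    refine (norm_sub_le _ _).trans ?_
    linarith [norm_charFunction_le hd hn u, norm_exp_neg_hessForm_le hd u]
  · exact ((integrable_exp_neg_mul_sum_sq (decayRate_pos hd)).const_mul _).const_mul _
  · refine Eventually.of_forall fun u => ?_
    have := ((tendsto_charFunction hd u).sub_const
      (1 / 2 * Complex.exp (-(hessForm u / 2 : ℝ)))).norm
    rwa [sub_self, norm_zero] at this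

theorem integral_charFunction (n : ℕ) (hn : 0 < n) (s : Fin d →₀ ℕ) :
    ∫ u : Fin d → ℝ, charFunction d n u
        * Complex.exp (-((√(n : ℝ))⁻¹ * (dev d n s ⬝ᵥ u) : ℝ) * Complex.I)
      = ((2 * Real.pi) ^ d * √(n : ℝ) ^ d / 2 ^ n * coeffC d n s : ℝ) := by
  have hn' : (0 : ℝ) < n := by exact_mod_cast hn
  have hs0 : 0 < √(n : ℝ) := Real.sqrt_pos.2 hn'
  have hss : √(n : ℝ) * √(n : ℝ) = n := Real.mul_self_sqrt hn'.le
  let g : (Fin d → ℝ) → ℂ := (torusBox d).indicator fun θ => evalCoeff (torusPoint θ) n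
    * Complex.exp (-(∑ k, (s k : ℝ) * θ k : ℝ) * Complex.I)
  have hg : ∀ u : Fin d → ℝ, charFunction d n u
      * Complex.exp (-((√(n : ℝ))⁻¹ * (dev d n s ⬝ᵥ u) : ℝ) * Complex.I)
      = (2 ^ n)⁻¹ * g ((√(n : ℝ))⁻¹ • u) := by
    intro u
    -- The centering in `charFunction` and the deviation `s - n m` add up to `s`.
    have hphase : √(n : ℝ) * (mean d ⬝ᵥ u) + (√(n : ℝ))⁻¹ * (dev d n s ⬝ᵥ u)
        = ∑ k, (s k : ℝ) * ((√(n : ℝ))⁻¹ • u) k := by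
      simp only [dotProduct, dev, Pi.smul_apply, smul_eq_mul, Finset.mul_sum,
        ← Finset.sum_add_distrib]
      refine Finset.sum_congr rfl fun k _ => ?_
      field_simp
      linear_combination (mean d k * u k) * hss
    simp only [g, charFunction]
    by_cases hu : (√(n : ℝ))⁻¹ • u ∈ torusBox d
    · rw [Set.indicator_of_mem hu, Set.indicator_of_mem hu, mul_assoc, ← Complex.exp_add,
        ← hphase, div_mul_eq_mul_div, div_eq_inv_mul]
      congr 3
      push_cast
      ring
    · rw [Set.indicator_of_notMem hu, Set.indicator_of_notMem hu]
      ring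
  simp only [hg]
  rw [MeasureTheory.integral_const_mul,
    MeasureTheory.Measure.integral_comp_smul MeasureTheory.volume g,
    MeasureTheory.integral_indicator measurableSet_torusBox, Module.finrank_fin_fun]
  unfold evalCoeff
  rw [integral_torusBox_aeval, coeffC, inv_pow, inv_inv, abs_of_pos (by positivity),
    Complex.real_smul]
  push_cast
  ring

theorem integral_limit_charFunction (hd : 1 ≤ d) {n : ℕ} (s : Fin d →₀ ℕ) :
    ∫ u : Fin d → ℝ, 1 / 2 * Complex.exp (-(hessForm u / 2 : ℝ))
        * Complex.exp (-((√(n : ℝ))⁻¹ * (dev d n s ⬝ᵥ u) : ℝ) * Complex.I)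
      = (1 / 2 * ((2 * Real.pi) ^ ((d : ℝ) / 2) / √(hess d).det * gauss d n s) : ℝ) := by
  have h := integral_cexp_neg_quadratic (posDef_hess hd) (-(√(n : ℝ))⁻¹ • dev d n s)
  have e : ∀ u : Fin d → ℝ, 1 / 2 * Complex.exp (-(hessForm u / 2 : ℝ))
        * Complex.exp (-((√(n : ℝ))⁻¹ * (dev d n s ⬝ᵥ u) : ℝ) * Complex.I)
      = 1 / 2 * Complex.exp (-((u ⬝ᵥ hess d *ᵥ u) / 2 : ℝ)
        + Complex.I * ((-(√(n : ℝ))⁻¹ • dev d n s) ⬝ᵥ u : ℝ)) := by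
    intro u
    rw [mul_assoc, ← Complex.exp_add, hessForm, smul_dotProduct, smul_eq_mul]
    congr 2
    push_cast
    ring
  simp only [e]
  rw [MeasureTheory.integral_const_mul, h, Fintype.card_fin, gauss, Matrix.smul_vecMul,
    smul_dotProduct, dotProduct_smul, smul_eq_mul, smul_eq_mul]
  have e2 : -(-(√(n : ℝ))⁻¹ * (-(√(n : ℝ))⁻¹ * (dev d n s ᵥ* (hess d)⁻¹ ⬝ᵥ dev d n s))) / 2
      = -(dev d n s ᵥ* (hess d)⁻¹ ⬝ᵥ dev d n s) / (2 * n) := by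
    have : (√(n : ℝ))⁻¹ * (√(n : ℝ))⁻¹ = (n : ℝ)⁻¹ := by
      rw [← mul_inv, Real.mul_self_sqrt (Nat.cast_nonneg n)]
    rw [div_mul_eq_div_div, div_eq_mul_inv _ (n : ℝ), ← this]
    ring
  rw [e2]
  push_cast
  rfl

/-- The uniform error of the Gaussian approximation is controlled by the `L¹` distance of the
characteristic functions. -/
theorem abs_coeffC_div_sub_gauss_le (hd : 1 ≤ d) {n : ℕ} (hn : 0 < n) (s : Fin d →₀ ℕ) :
    |coeffC d n s / A d n - gauss d n s|
      ≤ 2 * √(hess d).det / (2 * Real.pi) ^ ((d : ℝ) / 2) * ∫ u : Fin d → ℝ,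
        ‖charFunction d n u - 1 / 2 * Complex.exp (-(hessForm u / 2 : ℝ))‖ := by
  have hn' : (0 : ℝ) < n := by exact_mod_cast hn
  have hs0 : 0 < √(n : ℝ) := Real.sqrt_pos.2 hn'
  have hpi := Real.pi_pos
  have hdet : 0 < √(hess d).det := Real.sqrt_pos.2 (posDef_hess hd).det_pos
  have hdom := (integrable_exp_neg_mul_sum_sq (d := d) (decayRate_pos hd)).const_mul (2 ^ d)
  let phase : (Fin d → ℝ) → ℂ := fun u =>
    Complex.exp (-((√(n : ℝ))⁻¹ * (dev d n s ⬝ᵥ u) : ℝ) * Complex.I)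
  have hphase_meas : Measurable phase := by
    simp only [phase]
    unfold dotProduct
    exact Continuous.measurable (by fun_prop)
  have hphase : ∀ u, ‖phase u‖ = 1 := fun u => by
    simp only [phase]
    rw [← Complex.ofReal_neg, Complex.norm_exp_ofReal_mul_I]
  have hF : MeasureTheory.Integrable fun u => charFunction d n u * phase u := by
    refine hdom.mono' ((measurable_charFunction n).mul hphase_meas).aestronglyMeasurable
      (Eventually.of_forall fun u => ?_)
    rw [norm_mul, hphase, mul_one]
    exact norm_charFunction_le hd hn u
  have hG : MeasureTheory.Integrable fun u : Fin d → ℝ =>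
      1 / 2 * Complex.exp (-(hessForm u / 2 : ℝ)) * phase u := by
    refine hdom.mono' (measurable_exp_neg_hessForm.mul hphase_meas).aestronglyMeasurable
      (Eventually.of_forall fun u => ?_)
    rw [norm_mul, hphase, mul_one]
    exact norm_exp_neg_hessForm_le hd u
  set C := 2 * √(hess d).det / (2 * Real.pi) ^ ((d : ℝ) / 2) with hC
  have hC0 : 0 ≤ C := by positivity
  have hdiff := MeasureTheory.integral_sub hF hG
  simp only [phase] at hdiff
  rw [integral_charFunction n hn s, integral_limit_charFunction hd s, ← Complex.ofReal_sub] at hdiff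
  set P := (2 * Real.pi) ^ ((d : ℝ) / 2) with hP
  have hP0 : 0 < P := by positivity
  have hPP : (2 * Real.pi) ^ d = P * P := by
    rw [hP, ← Real.rpow_add (by positivity), add_halves, Real.rpow_natCast]
  have hnp : (n : ℝ) ^ (-((d : ℝ) / 2)) = (√(n : ℝ) ^ d)⁻¹ := by
    rw [Real.rpow_neg hn'.le, Real.sqrt_eq_rpow, ← Real.rpow_natCast, ← Real.rpow_mul hn'.le]
    congr 2
    ring
  have hA : coeffC d n s / A d n - gauss d n s
      = C * ((2 * Real.pi) ^ d * √(n : ℝ) ^ d / 2 ^ n * coeffC d n s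
        - 1 / 2 * (P / √(hess d).det * gauss d n s)) := by
    rw [A_eq, hnp, ← hP, hPP, hC]
    field_simp
  rw [hA, abs_mul, abs_of_nonneg hC0]
  refine mul_le_mul_of_nonneg_left ?_ hC0
  rw [← Real.norm_eq_abs, ← Complex.norm_real, ← hdiff]
  refine (MeasureTheory.norm_integral_le_integral_norm _).trans (le_of_eq ?_)
  refine MeasureTheory.integral_congr_ae (Eventually.of_forall fun u => ?_)
  simp only
  rw [← sub_mul, norm_mul]
  have := hphase u
  simp only [phase] at this
  rw [this, mul_one]

/-- The local limit theorem, with an error bound independent of `s`. -/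
theorem exists_tendsto_zero_abs_le (hd : 1 ≤ d) : ∃ ε : ℕ → ℝ, Tendsto ε atTop (𝓝 0) ∧
    ∀ n, 0 < n → ∀ s, |coeffC d n s / A d n - gauss d n s| ≤ ε n := by
  have h := (tendsto_integral_norm_charFunction_sub hd).const_mul
    (2 * √(hess d).det / (2 * Real.pi) ^ ((d : ℝ) / 2))
  rw [mul_zero] at h
  exact ⟨_, h, fun _ hn s => abs_coeffC_div_sub_gauss_le hd hn s⟩

/-! ### The maximum coefficient -/

theorem A_pos (hd : 1 ≤ d) {n : ℕ} (hn : 0 < n) : 0 < A d n := by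
  have hn' : (0 : ℝ) < n := by exact_mod_cast hn
  have hpi := Real.pi_pos
  have hdet := (posDef_hess hd).det_pos
  rw [A_eq]
  positivity

theorem gauss_le_one (hd : 1 ≤ d) (n : ℕ) (s : Fin d →₀ ℕ) : gauss d n s ≤ 1 := by
  have h := (posDef_hess hd).inv.posSemidef.dotProduct_mulVec_nonneg (dev d n s)
  rw [star_trivial, Matrix.dotProduct_mulVec] at h
  exact Real.exp_le_one_iff.2 (div_nonpos_of_nonpos_of_nonneg (neg_nonpos.2 h) (by positivity))

theorem exists_isGreatest_coeffC (d n : ℕ) :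
    ∃ M, IsGreatest (Set.range fun s : Fin d →₀ ℕ => coeffC d n s) M := by
  have hfin : (Set.range fun s : Fin d →₀ ℕ => coeffC d n s).Finite := by
    refine ((PowerSeries.coeff n (genFun d)).support.finite_toSet.image
      (fun s => coeffC d n s) |>.insert 0).subset ?_
    rintro _ ⟨s, rfl⟩
    by_cases hs : s ∈ (PowerSeries.coeff n (genFun d)).support
    · exact Or.inr ⟨s, hs, rfl⟩
    · exact Or.inl (MvPolynomial.notMem_support_iff.1 hs)
  obtain ⟨M, hM⟩ := hfin.exists_maximal (Set.range_nonempty _)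
  exact ⟨M, hM.1, fun x hx => (le_total x M).elim id fun h => hM.2 hx h⟩

/-- The lattice point next to the mean `n m`, obtained by rounding down. -/
noncomputable def nearMean (d n : ℕ) : Fin d →₀ ℕ :=
  Finsupp.equivFunOnFinite.symm fun k => ⌊(n : ℝ) * mean d k⌋₊

theorem abs_dev_nearMean_le (n : ℕ) (k : Fin d) : |dev d n (nearMean d n) k| ≤ 1 := by
  have h0 : 0 ≤ (n : ℝ) * mean d k := by unfold mean; positivity
  have h1 := Nat.floor_le h0
  have h2 := Nat.lt_floor_add_one ((n : ℝ) * mean d k)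
  simp only [dev, nearMean, Finsupp.equivFunOnFinite_symm_apply_apply]
  rw [abs_le]
  constructor <;> linarith

theorem tendsto_gauss_nearMean (d : ℕ) :
    Tendsto (fun n => gauss d n (nearMean d n)) atTop (𝓝 1) := by
  set K := ∑ j : Fin d, ∑ i : Fin d, |(hess d)⁻¹ i j| with hK
  have hbound : ∀ n, |(dev d n (nearMean d n) ᵥ* (hess d)⁻¹) ⬝ᵥ dev d n (nearMean d n)| ≤ K := by
    intro n
    simp only [dotProduct, Matrix.vecMul]
    refine (Finset.abs_sum_le_sum_abs _ _).trans (Finset.sum_le_sum fun j _ => ?_)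
    rw [abs_mul]
    refine (mul_le_of_le_one_right (abs_nonneg _) (abs_dev_nearMean_le n j)).trans ?_
    refine (Finset.abs_sum_le_sum_abs _ _).trans (Finset.sum_le_sum fun i _ => ?_)
    rw [abs_mul]
    exact mul_le_of_le_one_left (abs_nonneg _) (abs_dev_nearMean_le n i)
  have h0 : Tendsto (fun n : ℕ => -((dev d n (nearMean d n) ᵥ* (hess d)⁻¹)
      ⬝ᵥ dev d n (nearMean d n)) / (2 * (n : ℝ))) atTop (𝓝 0) := by
    have hlim : Tendsto (fun n : ℕ => K / (2 * (n : ℝ))) atTop (𝓝 0) :=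
      (tendsto_natCast_atTop_atTop.const_mul_atTop (by norm_num : (0 : ℝ) < 2)).const_div_atTop K
    refine squeeze_zero_norm (fun n => ?_) hlim
    rw [Real.norm_eq_abs, abs_div, abs_neg, abs_of_nonneg (by positivity : (0 : ℝ) ≤ 2 * n)]
    gcongr
    exact hbound n
  have := (Real.continuous_exp.tendsto 0).comp h0
  rwa [Real.exp_zero] at this

theorem isEquivalent_max (hd : 1 ≤ d) {M : ℕ → ℝ}
    (hM : ∀ n : ℕ, IsGreatest (Set.range fun s : Fin d →₀ ℕ => coeffC d n s) (M n)) :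
    Asymptotics.IsEquivalent atTop M (fun n : ℕ => A d n) := by
  obtain ⟨ε, hε, hle⟩ := exists_tendsto_zero_abs_le hd
  have hne : ∀ᶠ n in atTop, A d n ≠ 0 :=
    (eventually_gt_atTop 0).mono fun n hn => (A_pos hd hn).ne'
  rw [Asymptotics.isEquivalent_iff_tendsto_one hne]
  have hlow := (tendsto_gauss_nearMean d).sub hε
  have hupp := hε.const_add 1
  rw [sub_zero] at hlow
  rw [add_zero] at hupp
  refine tendsto_of_tendsto_of_tendsto_of_le_of_le' hlow hupp ?_ ?_
  · filter_upwards [eventually_gt_atTop 0] with n hn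
    have h1 := (abs_le.1 (hle n hn (nearMean d n))).1
    have h2 : coeffC d n (nearMean d n) / A d n ≤ M n / A d n :=
      div_le_div_of_nonneg_right ((hM n).2 ⟨_, rfl⟩) (A_pos hd hn).le
    simp only [Pi.div_apply]
    linarith
  · filter_upwards [eventually_gt_atTop 0] with n hn
    obtain ⟨s, hs⟩ := (hM n).1
    have h1 := (abs_le.1 (hle n hn s)).2
    have h2 := gauss_le_one hd n s
    simp only [Pi.div_apply, ← hs]
    linarith

theorem tendsto_iSup_ofReal_abs (hd : 1 ≤ d) :
    Tendsto (fun n : ℕ => ⨆ s : Fin d →₀ ℕ,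
      ENNReal.ofReal |coeffC d n s / A d n - gauss d n s|) atTop (𝓝 0) := by
  obtain ⟨ε, hε, hle⟩ := exists_tendsto_zero_abs_le hd
  have h := ENNReal.tendsto_ofReal hε
  rw [ENNReal.ofReal_zero] at h
  refine tendsto_of_tendsto_of_tendsto_of_le_of_le' tendsto_const_nhds h
    (Eventually.of_forall fun _ => zero_le) ?_
  filter_upwards [eventually_gt_atTop 0] with n hn
  exact iSup_le fun s => ENNReal.ofReal_le_ofReal (hle n hn s)

end CompositionLCLT

theorem theorem4p4 (d : ℕ) (hd : 1 ≤ d) :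
    -- the coefficients count compositions by size and by occurrences of `1, …, d`
    (∀ (n : ℕ) (s : Fin d →₀ ℕ),
      CompositionLCLT.coeffC d n s = (CompositionLCLT.numCompositions d n s : ℝ)) ∧
    -- the maximum coefficient of `[t^n] C(z, t)` exists and is asymptotic to `A_n`
    (∃ M : ℕ → ℝ,
      (∀ n : ℕ, IsGreatest (Set.range fun s : Fin d →₀ ℕ => CompositionLCLT.coeffC d n s) (M n)) ∧
      Asymptotics.IsEquivalent atTop M (fun n : ℕ => CompositionLCLT.A d n)) ∧
    -- the Hessian is nonsingular
    (CompositionLCLT.hess d).det ≠ 0 ∧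
    -- the uniform local central limit theorem, with the supremum taken in `[0, ∞]`
    Tendsto
      (fun n : ℕ => ⨆ s : Fin d →₀ ℕ,
        ENNReal.ofReal
          |CompositionLCLT.coeffC d n s / CompositionLCLT.A d n - CompositionLCLT.gauss d n s|)
      atTop (𝓝 0) := by
  choose M hM using CompositionLCLT.exists_isGreatest_coeffC d
  exact ⟨CompositionLCLT.coeffC_eq_numCompositions d,
    ⟨M, hM, CompositionLCLT.isEquivalent_max hd hM⟩,
    (CompositionLCLT.posDef_hess hd).det_pos.ne',
    CompositionLCLT.tendsto_iSup_ofReal_abs hd⟩
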